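/- \textbf{Setting.} Let $\mathcal X$ be a separable metric space and $\mathcal Y$ a real separable Hilbert space, both with their Borel $\sigma$-algebras. Let $(\varphi_\gamma)_{\gamma\in\Gamma}$ be a countable family of measurable functions $\varphi_\gamma:\mathcal X\to\mathcal Y$ such that, for some finite $\kappa$, $\sum_{\gamma\in\Gamma}\|\varphi_\gamma(x)\|^2\le\kappa$ for all $x\in\mathcal X$. For $\beta=(\beta_\gamma)_{\gamma\in\Gamma}\in\ell_2(\Gamma)$ put $f_\beta(x)=\sum_{\gamma}\beta_\gamma\varphi_\gamma(x)$. Let $w_\gamma\ge 0$ $(\gamma\in\Gamma)$ be fixed weights, let $\varepsilon>0$, and put $$p_\varepsilon(\beta)=\sum_{\gamma\in\Gamma}\bigl(w_\gamma|\beta_\gamma|+\varepsilon\beta_\gamma^2\bigr)\in[0,\infty].$$ Let $(X,Y)$ be a random pair in $\mathcal X\times\mathcal Y$ with distribution $P$, and let $P_X$ be the distribution of $X$. Assume $Y=f^*(X)+W$, where $f^*:\mathcal X\to\mathcal Y$ is measurable and bounded (no sparsity and no representation $f^*=f_{\beta^*}$ is assumed) and, for some $\sigma,L>0$, almost surely $$\mathbb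 E[W\mid X]=0,\qquad \mathbb E\Bigl[\exp\bigl(\tfrac{\|W\|}{L}\bigr)-\tfrac{\|W\|}{L}-1\,\Big|\,X\Bigr]\le\frac{\sigma^2}{2L^2}.$$ Let $(X_i,Y_i)_{i\ge1}$ be independent random pairs with distribution $P$. Let $(\lambda_n)_{n\ge1}$ be a deterministic sequence of positive numbers. \textbf{Theorem (universal strong consistency).} Assume that the linear span of $\{\varphi_\gamma\}_{\gamma\in\Gamma}$ is dense in $L^2(\mathcal X,P_X;\mathcal Y)$, and that $$\lim_{n\to\infty}\lambda_n=0,\qquad \lim_{n\to\infty}\bigl(n\lambda_n^2-2\log n\bigr)=+\infty .$$ Then for every $n\ge1$ the elastic-net functional $$\beta\mapsto\frac1n\sum_{i=1}^n\|Y_i-f_\beta(X_i)\|^2+\lambda_n\,p_\varepsilon(\beta)$$ has a unique minimizer $\beta_n$ on $\ell_2(\Gamma)$, and the estimator $f_n=f_{\beta_n}$ satisfies $$\lim_{n\to\infty}\mathbb E\|f_n(X)-f^*(X)\|^2=0\qquad\text{with probability }1,$$ where the expectation is taken over $X\sim P_X$ with the training sample $(X_i,Y_i)_{i\ge1}$ held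 fixed. -/

import Mathlib

open MeasureTheory ProbabilityTheory Filter Topology
open scoped ENNReal

noncomputable section

namespace ElasticNet

/-- The Hilbert space `ℓ₂(Γ)` of square-summable real families. -/
abbrev EllTwo (Γ : Type*) : Type _ := lp (fun _ : Γ => ℝ) 2

/-- The family `φ` consists of measurable functions with
`k(x) = ∑_γ ‖φ_γ(x)‖² ≤ κ` for every `x`. -/
structure IsFeatureFamily {Γ 𝒳 𝒴 : Type*} [MeasurableSpace 𝒳] [NormedAddCommGroup 𝒴]
    [MeasurableSpace 𝒴] (φ : Γ → 𝒳 → 𝒴) (κ : ℝ) : Prop where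
  measurable : ∀ γ, Measurable (φ γ)
  summable : ∀ x, Summable fun γ => ‖φ γ x‖ ^ 2
  bound : ∀ x, ∑' γ, ‖φ γ x‖ ^ 2 ≤ κ

/-- The function `f_β(x) = ∑_γ β_γ φ_γ(x)`. -/
def predictor {Γ 𝒳 𝒴 : Type*} [NormedAddCommGroup 𝒴] [NormedSpace ℝ 𝒴]
    (φ : Γ → 𝒳 → 𝒴) (β : EllTwo Γ) (x : 𝒳) : 𝒴 :=
  ∑' γ, β γ • φ γ x

/-- The elastic-net penalty `p_ε(β) = ∑_γ (w_γ |β_γ| + ε β_γ²) ∈ [0,∞]`. -/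
def penalty {Γ : Type*} (w : Γ → ℝ) (ε : ℝ) (β : EllTwo Γ) : ℝ≥0∞ :=
  ∑' γ, ENNReal.ofReal (w γ * |β γ| + ε * β γ ^ 2)

/-- The penalized empirical risk
`(1/n) ∑_i ‖y_i - f_β(x_i)‖² + lam · p_ε(β) ∈ [0,∞]` of the sample `s = ((x_i, y_i))_i`. -/
def empiricalFunctional {Γ 𝒳 𝒴 : Type*} [NormedAddCommGroup 𝒴] [NormedSpace ℝ 𝒴]
    (φ : Γ → 𝒳 → 𝒴) (w : Γ → ℝ) (ε lam : ℝ) {n : ℕ} (s : Fin n → 𝒳 × 𝒴)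
    (β : EllTwo Γ) : ℝ≥0∞ :=
  ENNReal.ofReal ((1 / (n : ℝ)) * ∑ i, ‖(s i).2 - predictor φ β (s i).1‖ ^ 2)
    + ENNReal.ofReal lam * penalty w ε β

/-- `β` is an elastic-net estimator for the sample `s`: it minimizes the penalized
empirical risk over all of `ℓ₂`. -/
def IsElasticNetEstimator {Γ 𝒳 𝒴 : Type*} [NormedAddCommGroup 𝒴] [NormedSpace ℝ 𝒴]
    (φ : Γ → 𝒳 → 𝒴) (w : Γ → ℝ) (ε lam : ℝ) {n : ℕ} (s : Fin n → 𝒳 × 𝒴)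
    (β : EllTwo Γ) : Prop :=
  ∀ β' : EllTwo Γ, empiricalFunctional φ w ε lam s β ≤ empiricalFunctional φ w ε lam s β'

/-- Under the law `P` of `(X, Y)`, the noise `W = Y - f(X)` satisfies `E[W | X] = 0` and
`E[exp(‖W‖/L) - ‖W‖/L - 1 | X] ≤ σ² / (2L²)` almost surely. The integrability fields say that
these conditional expectations are genuine ones. -/
structure IsNoise {𝒳 𝒴 : Type*} [MeasurableSpace 𝒳] [NormedAddCommGroup 𝒴]
    [NormedSpace ℝ 𝒴] [CompleteSpace 𝒴] [MeasurableSpace 𝒴]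
    (P : Measure (𝒳 × 𝒴)) (f : 𝒳 → 𝒴) (σ L : ℝ) : Prop where
  integrable : Integrable (fun z => z.2 - f z.1) P
  integrable_exp :
    Integrable (fun z => Real.exp (‖z.2 - f z.1‖ / L) - ‖z.2 - f z.1‖ / L - 1) P
  zero_mean :
    P[fun z => z.2 - f z.1 | MeasurableSpace.comap Prod.fst inferInstance] =ᵐ[P] 0
  moment :
    ∀ᵐ z ∂P,
      (P[fun z => Real.exp (‖z.2 - f z.1‖ / L) - ‖z.2 - f z.1‖ / L - 1
        | MeasurableSpace.comap Prod.fst inferInstance]) z ≤ σ ^ 2 / (2 * L ^ 2)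

/-- The linear span of the (classes of the) features is dense in `L²(𝒳, ν; 𝒴)`. -/
def SpanDense {Γ 𝒳 𝒴 : Type*} [MeasurableSpace 𝒳] [NormedAddCommGroup 𝒴]
    [NormedSpace ℝ 𝒴] (φ : Γ → 𝒳 → 𝒴) (ν : Measure 𝒳) : Prop :=
  Dense (Submodule.span ℝ {g : Lp 𝒴 2 ν | ∃ γ, (g : 𝒳 → 𝒴) =ᵐ[ν] φ γ} : Set (Lp 𝒴 2 ν))

/-- The prediction error `E‖f_β(X) - f(X)‖²`, for `(X, Y)` of law `P` and fixed `β`. -/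
def predictionError {Γ 𝒳 𝒴 : Type*} [MeasurableSpace 𝒳] [NormedAddCommGroup 𝒴]
    [NormedSpace ℝ 𝒴] [MeasurableSpace 𝒴] (φ : Γ → 𝒳 → 𝒴) (P : Measure (𝒳 × 𝒴))
    (f : 𝒳 → 𝒴) (β : EllTwo Γ) : ℝ≥0∞ :=
  ∫⁻ z, ‖predictor φ β z.1 - f z.1‖ₑ ^ 2 ∂P

end ElasticNet

end

/-! The ridge part of the penalty makes the functional uniformly convex on `ℓ₂`, which gives the
unique minimizer. For consistency, the minimizer is compared with a fixed `β₀` of finite penalty.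
The sample enters in only three ways: through the averaged noise vector `G` in `ℓ₂(Γ)`, the averaged
centred Gram matrix `K` in `ℓ₂(Γ × Γ)`, and the empirical error of `β₀`. The first two are means of
centred i.i.d. Hilbert-space vectors with an exponential moment, hence almost surely `O(√(log n /
n))`, which the rate condition turns into `O(λ_n)`. The third converges by the strong law.

With `Δ = β_n - β₀`, the noise contributes `2⟪Δ, G⟫`, which part of the ridge term `λ_n ε ‖β_n‖²`
absorbs (`IsElasticNetEstimator.empirical_error_le`). What is left of the ridge term also controls
`λ_n ‖Δ‖²`. Since `‖f_Δ(x)‖²` is linear in `Δ ⊗ Δ` (`norm_predictor_sq`), passing from the empirical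
to the population norm costs at most `‖K‖ ‖Δ‖² = O(λ_n ‖Δ‖²)`, which is therefore already paid for
(`inner_tensorSq_le`). No a priori bound on `β_n` is needed.

Hence the limsup of the prediction error is at most a constant, independent of `β₀`, times the
approximation error of `β₀`. By density of the span the latter is arbitrarily small. -/

namespace ElasticNet

/-! ### Concentration of sums of independent Hilbert-space vectors -/

section Concentration

/-- The power series of `cosh` in the squared variable has nonnegative coefficients, so `cosh √u` is
convex in `u ≥ 0`, term by term. -/
lemma cosh_le_of_sq_eq {r p q θ : ℝ} (h0 : 0 ≤ θ) (h1 : θ ≤ 1)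
    (h : r ^ 2 = θ * p ^ 2 + (1 - θ) * q ^ 2) :
    Real.cosh r ≤ θ * Real.cosh p + (1 - θ) * Real.cosh q := by
  refine hasSum_le (fun n => ?_) (Real.hasSum_cosh r)
    (((Real.hasSum_cosh p).mul_left θ).add ((Real.hasSum_cosh q).mul_left (1 - θ)))
  have hc := (convexOn_pow n).2 (sq_nonneg p) (sq_nonneg q) h0 (sub_nonneg.2 h1) (by ring)
  simp only [smul_eq_mul] at hc
  rw [← mul_div_assoc, ← mul_div_assoc, ← add_div, pow_mul, pow_mul, pow_mul, h]
  gcongr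

variable {E : Type*} [NormedAddCommGroup E] [InnerProductSpace ℝ E]

/-- With `c` the cosine of the angle, `‖x + y‖²` interpolates between `(a + b)²` and `(a - b)²`, so
convexity gives `cosh a cosh b + c sinh a sinh b`. Splitting `sinh b = b + (sinh b - b)` isolates
the term linear in `y`, which has mean zero when `y` is centred and independent of `x`; the rest is
at most `cosh a (exp b - b)`. -/
lemma cosh_norm_add_le (x y : E) :
    Real.cosh ‖x + y‖ ≤ inner ℝ ((Real.sinh ‖x‖ / ‖x‖) • x) y
      + Real.cosh ‖x‖ * (Real.exp ‖y‖ - ‖y‖) := by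
  set a := ‖x‖ with ha
  set b := ‖y‖ with hb
  have ha0 : 0 ≤ a := norm_nonneg x
  have hb0 : 0 ≤ b := norm_nonneg y
  set c := inner ℝ x y / (a * b) with hc
  have hc1 : |c| ≤ 1 := abs_real_inner_div_norm_mul_norm_le_one x y
  have hxy : inner ℝ x y = c * (a * b) := by
    by_cases hab : a * b = 0
    · rcases mul_eq_zero.1 hab with h | h
      · rw [hab, norm_eq_zero.1 h]; simp
      · rw [hab, norm_eq_zero.1 h]; simp
    · rw [hc, div_mul_cancel₀ _ hab]
  have hlin : inner ℝ ((Real.sinh a / a) • x) y = c * b * Real.sinh a := by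
    rw [real_inner_smul_left, hxy]
    by_cases h : a = 0
    · simp [h]
    · field_simp
  have hsq : ‖x + y‖ ^ 2 = (1 + c) / 2 * (a + b) ^ 2 + (1 - (1 + c) / 2) * (a - b) ^ 2 := by
    rw [norm_add_sq_real, hxy]; ring
  obtain ⟨hcl, hcu⟩ := abs_le.1 hc1
  have hmain := cosh_le_of_sq_eq (by linarith) (by linarith) hsq
  rw [Real.cosh_add, Real.cosh_sub] at hmain
  have hsb : 0 ≤ Real.sinh b - b := sub_nonneg.2 (Real.self_le_sinh_iff.2 hb0)
  have hsa : 0 ≤ Real.sinh a := Real.sinh_nonneg_iff.2 ha0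
  have hsc : Real.sinh a ≤ Real.cosh a := (Real.sinh_lt_cosh a).le
  have hcs : 0 ≤ Real.cosh a - c * Real.sinh a := by nlinarith
  rw [hlin, ← Real.cosh_add_sinh b]
  nlinarith [mul_nonneg hsb hcs]

variable [CompleteSpace E]

lemma integral_cosh_norm_add_le {A B : Type*} [MeasurableSpace A] [MeasurableSpace B]
    (ν : Measure A) [IsProbabilityMeasure ν] (P : Measure B) [IsProbabilityMeasure P]
    {U : A → E} {ξ : B → E} (hU : StronglyMeasurable U) (hξ : StronglyMeasurable ξ)
    (hξ0 : ∫ b, ξ b ∂P = 0) (hUi : Integrable (fun a => Real.cosh ‖U a‖) ν)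
    (hξi : Integrable (fun b => Real.exp ‖ξ b‖) P) :
    Integrable (fun p : A × B => Real.cosh ‖U p.1 + ξ p.2‖) (ν.prod P) ∧
      ∫ p : A × B, Real.cosh ‖U p.1 + ξ p.2‖ ∂(ν.prod P)
        ≤ (∫ a, Real.cosh ‖U a‖ ∂ν) * ∫ b, (Real.exp ‖ξ b‖ - ‖ξ b‖) ∂P := by
  have hξn : Integrable ξ P := by
    refine hξi.mono' hξ.aestronglyMeasurable (ae_of_all _ fun b => ?_)
    linarith [Real.add_one_le_exp ‖ξ b‖]
  set V : A → E := fun a => (Real.sinh ‖U a‖ / ‖U a‖) • U a with hV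
  have hVm : StronglyMeasurable V := by
    have h1 : Measurable fun a => ‖U a‖ := hU.norm.measurable
    have h2 : Measurable fun a => Real.sinh ‖U a‖ / ‖U a‖ :=
      (Real.measurable_sinh.comp h1).div h1
    exact h2.stronglyMeasurable.smul hU
  have hVi : Integrable V ν := by
    refine hUi.mono' hVm.aestronglyMeasurable (ae_of_all _ fun a => ?_)
    rw [hV, norm_smul, norm_div, norm_norm]
    have hs : 0 ≤ Real.sinh ‖U a‖ := Real.sinh_nonneg_iff.2 (norm_nonneg _)
    rw [Real.norm_of_nonneg hs]
    have h3 : Real.sinh ‖U a‖ / ‖U a‖ * ‖U a‖ ≤ Real.sinh ‖U a‖ := by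
      by_cases h : ‖U a‖ = 0
      · simp [h]
      · rw [div_mul_cancel₀ _ h]
    exact h3.trans (Real.sinh_lt_cosh _).le
  have hinner : Integrable (fun p : A × B => inner ℝ (V p.1) (ξ p.2)) (ν.prod P) := by
    refine (hVi.norm.mul_prod hξn.norm).mono'
      ((hVm.comp_measurable measurable_fst).inner
        (hξ.comp_measurable measurable_snd)).aestronglyMeasurable (ae_of_all _ fun p => ?_)
    exact norm_inner_le_norm _ _
  have hprod : Integrable (fun p : A × B =>
      Real.cosh ‖U p.1‖ * (Real.exp ‖ξ p.2‖ - ‖ξ p.2‖)) (ν.prod P) :=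
    hUi.mul_prod (hξi.sub hξn.norm)
  have hsum := hinner.add hprod
  have hle : ∀ p : A × B, Real.cosh ‖U p.1 + ξ p.2‖ ≤
      inner ℝ (V p.1) (ξ p.2) + Real.cosh ‖U p.1‖ * (Real.exp ‖ξ p.2‖ - ‖ξ p.2‖) :=
    fun p => cosh_norm_add_le _ _
  have hint : Integrable (fun p : A × B => Real.cosh ‖U p.1 + ξ p.2‖) (ν.prod P) := by
    refine hsum.mono' ?_ (ae_of_all _ fun p => ?_)
    · exact (Real.measurable_cosh.comp ((hU.comp_measurable measurable_fst).add
        (hξ.comp_measurable measurable_snd)).norm.measurable).aestronglyMeasurable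
    · rw [Real.norm_of_nonneg (Real.cosh_pos _).le]; exact hle p
  refine ⟨hint, (integral_mono hint hsum hle).trans ?_⟩
  have hzero : ∫ p : A × B, inner ℝ (V p.1) (ξ p.2) ∂(ν.prod P) = 0 := by
    rw [integral_prod _ hinner]
    simp [integral_inner hξn, hξ0]
  simp only [Pi.add_apply]
  rw [integral_add hinner hprod, hzero, zero_add]
  exact (integral_prod_mul (fun a => Real.cosh ‖U a‖) fun b => Real.exp ‖ξ b‖ - ‖ξ b‖).le

variable {Ω S : Type*} [MeasurableSpace Ω] [MeasurableSpace S] {μ : Measure Ω}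
  [IsProbabilityMeasure μ] {P : Measure S} [IsProbabilityMeasure P] {Z : ℕ → Ω → S} {ξ : S → E}

lemma integral_cosh_norm_sum_le (hZ_meas : ∀ i, Measurable (Z i))
    (hZ_law : ∀ i, μ.map (Z i) = P) (hZ_indep : iIndepFun Z μ)
    (hξ : StronglyMeasurable ξ) (hξ0 : ∫ b, ξ b ∂P = 0)
    (hξi : Integrable (fun b => Real.exp ‖ξ b‖) P) (n : ℕ) :
    Integrable (fun ω => Real.cosh ‖∑ i ∈ Finset.range n, ξ (Z i ω)‖) μ ∧
      ∫ ω, Real.cosh ‖∑ i ∈ Finset.range n, ξ (Z i ω)‖ ∂μ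
        ≤ (∫ b, (Real.exp ‖ξ b‖ - ‖ξ b‖) ∂P) ^ n := by
  induction n with
  | zero => simp
  | succ n ih =>
    obtain ⟨ih1, ih2⟩ := ih
    -- The first `n` samples are bundled into one variable, so that the joint law with the next
    -- sample is a product and the two-variable bound applies.
    set T : Ω → (Finset.range n → S) := fun ω i => Z i ω with hT
    have hTm : Measurable T := measurable_pi_lambda _ fun i => hZ_meas i
    have hind : IndepFun T (Z n) μ := by
      have h := hZ_indep.indepFun_finset (Finset.range n) {n} (by simp) hZ_meas
      exact h.comp measurable_id (measurable_pi_apply (⟨n, by simp⟩ : ({n} : Finset ℕ)))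
    have hlaw : μ.map (fun ω => (T ω, Z n ω)) = (μ.map T).prod P := by
      rw [(indepFun_iff_map_prod_eq_prod_map_map hTm.aemeasurable
        (hZ_meas n).aemeasurable).1 hind, hZ_law]
    have : IsProbabilityMeasure (μ.map T) := Measure.isProbabilityMeasure_map hTm.aemeasurable
    set U : (Finset.range n → S) → E := fun a => ∑ i, ξ (a i) with hU
    have hUm : StronglyMeasurable U :=
      Finset.stronglyMeasurable_fun_sum _ fun i _ => hξ.comp_measurable (measurable_pi_apply i)
    have hUT : ∀ ω, U (T ω) = ∑ i ∈ Finset.range n, ξ (Z i ω) := fun ω =>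
      Finset.sum_coe_sort (Finset.range n) fun i => ξ (Z i ω)
    have hcU : StronglyMeasurable fun a => Real.cosh ‖U a‖ :=
      (Real.measurable_cosh.comp hUm.norm.measurable).stronglyMeasurable
    have hUi : Integrable (fun a => Real.cosh ‖U a‖) (μ.map T) := by
      rw [integrable_map_measure hcU.aestronglyMeasurable hTm.aemeasurable]
      simpa only [Function.comp_def, hUT] using ih1
    obtain ⟨h1, h2⟩ := integral_cosh_norm_add_le (μ.map T) P hUm hξ hξ0 hUi hξi
    have hpm : Measurable fun ω => (T ω, Z n ω) := hTm.prodMk (hZ_meas n)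
    rw [← hlaw] at h1 h2
    have hsm := h1.aestronglyMeasurable
    rw [integrable_map_measure hsm hpm.aemeasurable] at h1
    rw [integral_map hpm.aemeasurable hsm,
      integral_map hTm.aemeasurable hcU.aestronglyMeasurable] at h2
    simp only [Function.comp_def, hUT, ← Finset.sum_range_succ (fun i => ξ (Z i _))] at h1 h2
    refine ⟨h1, h2.trans ?_⟩
    rw [pow_succ]
    refine mul_le_mul_of_nonneg_right ih2 (integral_nonneg fun b => ?_)
    have := Real.add_one_le_exp ‖ξ b‖
    simp only [Pi.zero_apply]
    linarith

end Concentration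

/-- The series starts at order two, and `s ^ k ≤ s ^ 2` for `k ≥ 2` and `0 ≤ s ≤ 1`. -/
lemma exp_mul_sub_le {s b : ℝ} (hs0 : 0 ≤ s) (hs1 : s ≤ 1) (hb : 0 ≤ b) :
    Real.exp (s * b) - s * b - 1 ≤ s ^ 2 * (Real.exp b - b - 1) := by
  have key : ∀ x : ℝ, HasSum (fun n : ℕ => x ^ (n + 2) / ((n + 2).factorial : ℝ))
      (Real.exp x - x - 1) := by
    intro x
    have h := NormedSpace.expSeries_div_hasSum_exp (𝔸 := ℝ) x
    rw [← Real.exp_eq_exp_ℝ] at h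
    have h2 := (hasSum_nat_add_iff' (f := fun n : ℕ => x ^ n / (n.factorial : ℝ)) 2).2 h
    have h3 : Real.exp x - ∑ i ∈ Finset.range 2, x ^ i / (i.factorial : ℝ)
        = Real.exp x - x - 1 := by
      simp [Finset.sum_range_succ]
      ring
    rwa [h3] at h2
  refine hasSum_le (fun n => ?_) (key (s * b)) ((key b).mul_left (s ^ 2))
  rw [mul_pow, ← mul_div_assoc]
  gcongr ?_ / _
  gcongr ?_ * _
  exact pow_le_pow_of_le_one hs0 hs1 (by omega)

section Concentration

variable {E : Type*} [NormedAddCommGroup E] [InnerProductSpace ℝ E] [CompleteSpace E]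
  {Ω S : Type*} [MeasurableSpace Ω] [MeasurableSpace S] {μ : Measure Ω}
  [IsProbabilityMeasure μ] {P : Measure S} [IsProbabilityMeasure P] {Z : ℕ → Ω → S} {ξ : S → E}

/-- One exponential moment, at level `a`, serves all `t ≤ a`: the second-order remainder at `t` is
at most `(t / a)²` times that at `a`. Then `1 + x ≤ exp x` turns the `n`-th power into an
exponential. -/
lemma integral_cosh_mul_norm_sum_le (hZ_meas : ∀ i, Measurable (Z i))
    (hZ_law : ∀ i, μ.map (Z i) = P) (hZ_indep : iIndepFun Z μ)
    (hξ : StronglyMeasurable ξ) (hξ0 : ∫ b, ξ b ∂P = 0) {a : ℝ} (ha : 0 < a)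
    (hξi : Integrable (fun b => Real.exp (a * ‖ξ b‖)) P) {t : ℝ} (ht : 0 ≤ t) (hta : t ≤ a)
    (n : ℕ) :
    Integrable (fun ω => Real.cosh (t * ‖∑ i ∈ Finset.range n, ξ (Z i ω)‖)) μ ∧
      ∫ ω, Real.cosh (t * ‖∑ i ∈ Finset.range n, ξ (Z i ω)‖) ∂μ
        ≤ Real.exp (n * (t ^ 2 * ∫ b, (Real.exp (a * ‖ξ b‖) - a * ‖ξ b‖ - 1) / a ^ 2 ∂P)) := by
  have hn : Integrable (fun b => ‖ξ b‖) P := by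
    refine (hξi.div_const a).mono' hξ.norm.aestronglyMeasurable (ae_of_all _ fun b => ?_)
    rw [norm_norm, le_div_iff₀ ha]
    linarith [Real.add_one_le_exp (a * ‖ξ b‖)]
  have hti : Integrable (fun b => Real.exp (t * ‖ξ b‖)) P := by
    refine hξi.mono' (Real.measurable_exp.comp
      (hξ.norm.measurable.const_mul t)).aestronglyMeasurable (ae_of_all _ fun b => ?_)
    rw [Real.norm_of_nonneg (Real.exp_pos _).le]
    gcongr
  have hts : ∀ x : E, ‖t • x‖ = t * ‖x‖ := fun x => by rw [norm_smul, Real.norm_of_nonneg ht]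
  obtain ⟨h1, h2⟩ := integral_cosh_norm_sum_le (ξ := fun b => t • ξ b) hZ_meas hZ_law hZ_indep
    (hξ.const_smul t) (by rw [integral_smul, hξ0, smul_zero]) (by simpa only [hts] using hti) n
  simp only [← Finset.smul_sum, hts] at h1 h2
  refine ⟨h1, h2.trans ?_⟩
  have hvi : Integrable (fun b => (Real.exp (a * ‖ξ b‖) - a * ‖ξ b‖ - 1) / a ^ 2) P :=
    ((hξi.sub (hn.const_mul a)).sub (integrable_const 1)).div_const _
  have hle : ∫ b, (Real.exp (t * ‖ξ b‖) - t * ‖ξ b‖) ∂P ≤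
      1 + t ^ 2 * ∫ b, (Real.exp (a * ‖ξ b‖) - a * ‖ξ b‖ - 1) / a ^ 2 ∂P := by
    rw [← integral_const_mul]
    have h3 : ∫ b, (1 + t ^ 2 * ((Real.exp (a * ‖ξ b‖) - a * ‖ξ b‖ - 1) / a ^ 2)) ∂P
        = 1 + ∫ b, t ^ 2 * ((Real.exp (a * ‖ξ b‖) - a * ‖ξ b‖ - 1) / a ^ 2) ∂P := by
      rw [integral_add (integrable_const 1) (hvi.const_mul _)]
      simp
    rw [← h3]
    refine integral_mono (hti.sub (hn.const_mul t)) ((integrable_const 1).add (hvi.const_mul _))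
      fun b => ?_
    have h4 := exp_mul_sub_le (s := t / a) (b := a * ‖ξ b‖) (by positivity)
      ((div_le_one ha).2 hta) (by positivity)
    have h5 : t / a * (a * ‖ξ b‖) = t * ‖ξ b‖ := by field_simp
    rw [h5] at h4
    have h6 : (t / a) ^ 2 * (Real.exp (a * ‖ξ b‖) - a * ‖ξ b‖ - 1) =
      t ^ 2 * ((Real.exp (a * ‖ξ b‖) - a * ‖ξ b‖ - 1) / a ^ 2) := by ring
    linarith
  rw [Real.exp_nat_mul]
  refine pow_le_pow_left₀ (integral_nonneg fun b => ?_) (hle.trans ?_) n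
  · have := Real.add_one_le_exp (t * ‖ξ b‖)
    simp only [Pi.zero_apply]
    linarith
  · linarith [Real.add_one_le_exp
      (t ^ 2 * ∫ b, (Real.exp (a * ‖ξ b‖) - a * ‖ξ b‖ - 1) / a ^ 2 ∂P)]

/-- Sums of independent, identically distributed, centred random vectors with an exponential
moment are almost surely `O(√(n log n))`. -/
theorem exists_ae_eventually_norm_sum_le (hZ_meas : ∀ i, Measurable (Z i))
    (hZ_law : ∀ i, μ.map (Z i) = P) (hZ_indep : iIndepFun Z μ)
    (hξ : StronglyMeasurable ξ) (hξ0 : ∫ b, ξ b ∂P = 0) {a : ℝ} (ha : 0 < a)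
    (hξi : Integrable (fun b => Real.exp (a * ‖ξ b‖)) P) :
    ∃ C : ℝ, 0 < C ∧ ∀ᵐ ω ∂μ, ∀ᶠ n : ℕ in atTop,
      ‖∑ i ∈ Finset.range n, ξ (Z i ω)‖ ≤ C * √(n * Real.log n) := by
  set v := ∫ b, (Real.exp (a * ‖ξ b‖) - a * ‖ξ b‖ - 1) / a ^ 2 ∂P with hv
  have hv0 : 0 ≤ v := integral_nonneg fun b => by
    have := Real.add_one_le_exp (a * ‖ξ b‖)
    simp only [Pi.zero_apply]
    exact div_nonneg (by linarith) (by positivity)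
  -- At scale `t = √(log n / n)` the `cosh` moment is at most `n ^ v`, while exceeding the threshold
  -- forces `cosh ≥ n ^ (v + 2) / 2`. By Markov the probability is at most `2 / n²`, which is
  -- summable for Borel–Cantelli.
  refine ⟨v + 2, by linarith, ?_⟩
  set s : ℕ → Set Ω := fun n =>
    {ω | (v + 2) * √(n * Real.log n) < ‖∑ i ∈ Finset.range n, ξ (Z i ω)‖} with hs
  have hlog : Tendsto (fun n : ℕ => Real.log n / n) atTop (𝓝 0) :=
    Real.isLittleO_log_id_atTop.tendsto_div_nhds_zero.comp tendsto_natCast_atTop_atTop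
  -- Beyond `N` the scale `t` stays below `a`, where the moment bound is valid.
  obtain ⟨N, hN⟩ := eventually_atTop.1
    ((hlog.eventually (gt_mem_nhds (sq_pos_of_pos ha))).and (eventually_ge_atTop 1))
  have hbound : ∀ n ≥ N, μ (s n) ≤ ENNReal.ofReal (2 * (1 / (n : ℝ) ^ 2)) := by
    intro n hn
    obtain ⟨hna, hn1⟩ := hN n hn
    have hn0 : (0 : ℝ) < n := by exact_mod_cast hn1
    have hl0 : 0 ≤ Real.log n := Real.log_natCast_nonneg n
    set t := √(Real.log n / n) with ht
    have hta : t ≤ a := (Real.sqrt_le_left ha.le).2 hna.le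
    obtain ⟨h1, h2⟩ := integral_cosh_mul_norm_sum_le hZ_meas hZ_law hZ_indep hξ hξ0 ha hξi
      (Real.sqrt_nonneg _) hta n
    have ht2 : n * (t ^ 2 * v) = v * Real.log n := by
      rw [ht, Real.sq_sqrt (by positivity)]; field_simp
    rw [← hv, ht2] at h2
    have htr : t * √(n * Real.log n) = Real.log n := by
      rw [ht, ← Real.sqrt_mul (by positivity)]
      rw [show Real.log n / n * (n * Real.log n) = Real.log n ^ 2 by field_simp]
      exact Real.sqrt_sq hl0
    set F : Ω → ℝ := fun ω => Real.cosh (t * ‖∑ i ∈ Finset.range n, ξ (Z i ω)‖) with hF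
    set e := Real.exp ((v + 2) * Real.log n) / 2 with he
    have hsub : s n ⊆ {ω | e ≤ F ω} := by
      intro ω hω
      have h3 : (v + 2) * Real.log n ≤ t * ‖∑ i ∈ Finset.range n, ξ (Z i ω)‖ := by
        rw [← htr]
        have := mul_le_mul_of_nonneg_left (le_of_lt hω) (Real.sqrt_nonneg (Real.log n / n))
        rw [← ht] at this
        linarith
      have h4 := Real.exp_le_exp.2 h3
      simp only [Set.mem_ofPred_eq, he, hF, Real.cosh_eq]
      have := Real.exp_pos (-(t * ‖∑ i ∈ Finset.range n, ξ (Z i ω)‖))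
      linarith
    have hmk := mul_meas_ge_le_integral_of_nonneg (μ := μ) (f := F)
      (ae_of_all _ fun ω => (Real.cosh_pos _).le) h1 e
    have hreal : μ.real (s n) ≤ 2 * (1 / (n : ℝ) ^ 2) := by
      have h5 : e * μ.real (s n) ≤ Real.exp (v * Real.log n) :=
        (mul_le_mul_of_nonneg_left (measureReal_mono hsub) (by positivity)).trans (hmk.trans h2)
      have h6 : e = Real.exp (v * Real.log n) * (n : ℝ) ^ 2 / 2 := by
        rw [he, add_mul, Real.exp_add]
        congr 2
        rw [two_mul, Real.exp_add, Real.exp_log hn0]; ring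
      rw [h6] at h5
      have h7 := Real.exp_pos (v * Real.log n)
      have h8 : Real.exp (v * Real.log n) * ((n : ℝ) ^ 2 / 2 * μ.real (s n)) ≤
        Real.exp (v * Real.log n) * 1 := by linarith
      have h9 := le_of_mul_le_mul_left h8 h7
      rw [mul_one_div, le_div_iff₀ (by positivity)]
      linarith
    rw [← ofReal_measureReal]
    exact ENNReal.ofReal_le_ofReal hreal
  have hsummable : Summable fun n : ℕ => 2 * (1 / ((n + N : ℕ) : ℝ) ^ 2) :=
    ((summable_nat_add_iff N).2 (Real.summable_one_div_nat_pow.2 one_lt_two)).mul_left 2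
  have hfin : ∑' n, μ (s (n + N)) ≠ ∞ := by
    refine ne_top_of_le_ne_top hsummable.tsum_ofReal_ne_top ?_
    exact ENNReal.tsum_le_tsum fun n => hbound _ (Nat.le_add_left N n)
  filter_upwards [ae_eventually_notMem hfin] with ω hω
  obtain ⟨M, hM⟩ := eventually_atTop.1 hω
  refine eventually_atTop.2 ⟨M + N, fun n hn => ?_⟩
  have := hM (n - N) (by omega)
  rw [Nat.sub_add_cancel (by omega)] at this
  exact not_lt.1 this

end Concentration

/-! ### Square-summable families and tensor squares -/

section EllTwo

variable {ι : Type*}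

lemma hasSum_of_forall_eq {M : Type*} [AddCommMonoid M] [TopologicalSpace M] {f g : ι → M} {a : M}
    (hfg : ∀ i, f i = g i) (h : HasSum g a) : HasSum f a := by
  rwa [funext hfg]

lemma memℓp_two_of_summable_sq {f : ι → ℝ} (hf : Summable fun i => f i ^ 2) :
    Memℓp (E := fun _ : ι => ℝ) f 2 :=
  memℓp_gen (by simpa using hf)

lemma hasSum_sq (β : EllTwo ι) : HasSum (fun i => β i ^ 2) (‖β‖ ^ 2) := by
  have h := lp.hasSum_inner (𝕜 := ℝ) β β
  rw [real_inner_self_eq_norm_sq] at h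
  simpa [sq] using h

lemma norm_le_of_tsum_sq_le {β : EllTwo ι} {C : ℝ} (hC : 0 ≤ C) (h : ∑' i, β i ^ 2 ≤ C ^ 2) :
    ‖β‖ ≤ C := by
  rw [(hasSum_sq β).tsum_eq] at h
  exact (sq_le_sq₀ (norm_nonneg _) hC).1 h

/-- Each value is the limit of its finite coordinate truncations, which are strongly measurable. -/
lemma stronglyMeasurable_of_apply [Countable ι] {A : Type*} [MeasurableSpace A]
    {F : A → EllTwo ι} (hF : ∀ i, Measurable fun a => F a i) : StronglyMeasurable F := by
  classical
  refine stronglyMeasurable_of_tendsto (u := (atTop : Filter (Finset ι)))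
    (f := fun s a => ∑ i ∈ s, F a i • lp.single (E := fun _ : ι => ℝ) 2 i (1 : ℝ))
    (fun s => ?_) (tendsto_pi_nhds.2 fun a => ?_)
  · have h1 : ∀ i, StronglyMeasurable fun a =>
        F a i • lp.single (E := fun _ : ι => ℝ) 2 i (1 : ℝ) := fun i =>
      (hF i).stronglyMeasurable.smul_const _
    exact Finset.stronglyMeasurable_fun_sum s fun i _ => h1 i
  · have h := lp.hasSum_single (p := 2) (by simp) (F a)
    have h2 : ∀ i, F a i • lp.single (E := fun _ : ι => ℝ) 2 i (1 : ℝ)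
        = lp.single (E := fun _ : ι => ℝ) 2 i (F a i) := fun i => by
      rw [← lp.single_smul]; simp
    simpa only [h2, HasSum, SummationFilter.unconditional_filter] using h

lemma summable_sq_mul_sq {f : ι → ℝ} (hf : Summable fun i => f i ^ 2) :
    Summable fun p : ι × ι => f p.1 ^ 2 * f p.2 ^ 2 := by
  have h0 : 0 ≤ fun i => f i ^ 2 := fun i => sq_nonneg (f i)
  exact Summable.mul_of_nonneg (f := fun i => f i ^ 2) (g := fun i => f i ^ 2) hf hf h0 h0

/-- The tensor square `β ⊗ β`. -/
def tensorSq (β : EllTwo ι) : EllTwo (ι × ι) :=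
  ⟨fun p => β p.1 * β p.2, memℓp_two_of_summable_sq (by
    simp only [mul_pow]
    exact summable_sq_mul_sq (f := fun i => β i) (hasSum_sq β).summable)⟩

lemma tensorSq_apply (β : EllTwo ι) (p : ι × ι) : tensorSq β p = β p.1 * β p.2 := rfl

lemma norm_tensorSq_le (β : EllTwo ι) : ‖tensorSq β‖ ≤ ‖β‖ ^ 2 := by
  refine norm_le_of_tsum_sq_le (by positivity) ?_
  simp only [tensorSq_apply, mul_pow]
  have h := (hasSum_sq β).summable
  rw [← tsum_mul_tsum_of_summable_norm h.norm h.norm, (hasSum_sq β).tsum_eq]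
  exact (sq _).ge

end EllTwo

lemma inner_sq_le {𝒴 : Type*} [NormedAddCommGroup 𝒴] [InnerProductSpace ℝ 𝒴] (u v : 𝒴) :
    inner ℝ u v ^ 2 ≤ ‖u‖ ^ 2 * ‖v‖ ^ 2 := by
  rw [← mul_pow, ← sq_abs]
  gcongr
  exact abs_real_inner_le_norm _ _

/-! ### Predictors, adjoints and Gram matrices -/

namespace IsFeatureFamily

variable {Γ 𝒳 𝒴 : Type*} [MeasurableSpace 𝒳] [NormedAddCommGroup 𝒴]
  [MeasurableSpace 𝒴] {φ : Γ → 𝒳 → 𝒴} {κ : ℝ}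

lemma nonneg (hφ : IsFeatureFamily φ κ) (x : 𝒳) : 0 ≤ κ :=
  (tsum_nonneg fun γ => sq_nonneg ‖φ γ x‖).trans (hφ.bound x)

lemma summable_norm_sq_mul (hφ : IsFeatureFamily φ κ) (x : 𝒳) :
    Summable fun p : Γ × Γ => ‖φ p.1 x‖ ^ 2 * ‖φ p.2 x‖ ^ 2 :=
  summable_sq_mul_sq (f := fun γ => ‖φ γ x‖) (hφ.summable x)

variable [InnerProductSpace ℝ 𝒴]

/-- The adjoint of `β ↦ f_β(x)` applied to `y`, that is the family `⟪φ_γ(x), y⟫`. -/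
def adjoint (hφ : IsFeatureFamily φ κ) (x : 𝒳) (y : 𝒴) : EllTwo Γ :=
  ⟨fun γ => inner ℝ (φ γ x) y, memℓp_two_of_summable_sq
    (((hφ.summable x).mul_right _).of_nonneg_of_le (fun _ => sq_nonneg _)
      fun γ => inner_sq_le (φ γ x) y)⟩

lemma adjoint_apply (hφ : IsFeatureFamily φ κ)
    (x : 𝒳) (y : 𝒴) (γ : Γ) : hφ.adjoint x y γ = inner ℝ (φ γ x) y := rfl

lemma norm_adjoint_le (hφ : IsFeatureFamily φ κ) (x : 𝒳) (y : 𝒴) : ‖hφ.adjoint x y‖ ≤ √κ * ‖y‖ := by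
  refine norm_le_of_tsum_sq_le (by positivity) ?_
  rw [mul_pow, Real.sq_sqrt (hφ.nonneg x)]
  calc ∑' γ, hφ.adjoint x y γ ^ 2 ≤ ∑' γ, ‖φ γ x‖ ^ 2 * ‖y‖ ^ 2 :=
        (hasSum_sq _).summable.tsum_le_tsum (fun γ => inner_sq_le (φ γ x) y) ((hφ.summable x).mul_right _)
    _ ≤ κ * ‖y‖ ^ 2 := by rw [tsum_mul_right]; gcongr; exact hφ.bound x

lemma summable_norm (hφ : IsFeatureFamily φ κ)
    (β : EllTwo Γ) (x : 𝒳) : Summable fun γ => ‖β γ • φ γ x‖ := by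
  refine ((hasSum_sq β).summable.add (hφ.summable x)).of_nonneg_of_le
    (fun _ => norm_nonneg _) fun γ => ?_
  rw [norm_smul, Real.norm_eq_abs, ← sq_abs (β γ)]
  nlinarith [sq_nonneg (|β γ| - ‖φ γ x‖), sq_nonneg (|β γ| + ‖φ γ x‖)]

lemma hasSum_predictor [CompleteSpace 𝒴] (hφ : IsFeatureFamily φ κ) (β : EllTwo Γ) (x : 𝒳) :
    HasSum (fun γ => β γ • φ γ x) (predictor φ β x) :=
  (hφ.summable_norm β x).of_norm.hasSum

/-- Moves the dependence on `β` out of the pairing: noise summed over the sample becomes one `ℓ₂`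
vector, whose norm controls all `β` at once. -/
lemma inner_predictor [CompleteSpace 𝒴] (hφ : IsFeatureFamily φ κ) (β : EllTwo Γ) (x : 𝒳) (y : 𝒴) :
    inner ℝ (predictor φ β x) y = inner ℝ β (hφ.adjoint x y) := by
  have h1 := (hφ.hasSum_predictor β x).mapL ((innerSL ℝ).flip y)
  have h2 := lp.hasSum_inner (𝕜 := ℝ) β (hφ.adjoint x y)
  refine h1.unique ?_
  refine hasSum_of_forall_eq (fun γ => ?_) h2
  change inner ℝ (β γ • φ γ x) y = inner ℝ (β γ) (inner ℝ (φ γ x) y)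
  rw [real_inner_smul_left]
  simp [mul_comm]

lemma predictor_add [CompleteSpace 𝒴] (hφ : IsFeatureFamily φ κ) (β β' : EllTwo Γ) (x : 𝒳) :
    predictor φ (β + β') x = predictor φ β x + predictor φ β' x := by
  refine (hφ.hasSum_predictor _ x).unique ?_
  convert (hφ.hasSum_predictor β x).add (hφ.hasSum_predictor β' x) using 2 with γ
  simp [add_smul]

lemma predictor_smul [CompleteSpace 𝒴] (hφ : IsFeatureFamily φ κ) (c : ℝ) (β : EllTwo Γ) (x : 𝒳) :
    predictor φ (c • β) x = c • predictor φ β x := by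
  refine (hφ.hasSum_predictor _ x).unique ?_
  convert (hφ.hasSum_predictor β x).const_smul c using 2 with γ
  simp [mul_smul]

lemma predictor_sub [CompleteSpace 𝒴] (hφ : IsFeatureFamily φ κ) (β β' : EllTwo Γ) (x : 𝒳) :
    predictor φ (β - β') x = predictor φ β x - predictor φ β' x := by
  rw [eq_sub_iff_add_eq, ← hφ.predictor_add, sub_add_cancel]

/-- The adjoint identity is tested on the predictor itself. -/
lemma norm_predictor_le [CompleteSpace 𝒴] (hφ : IsFeatureFamily φ κ)
    (β : EllTwo Γ) (x : 𝒳) : ‖predictor φ β x‖ ≤ √κ * ‖β‖ := by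
  have h := hφ.inner_predictor β x (predictor φ β x)
  rw [real_inner_self_eq_norm_sq] at h
  have h2 := (real_inner_le_norm β (hφ.adjoint x (predictor φ β x))).trans
    (mul_le_mul_of_nonneg_left (hφ.norm_adjoint_le x _) (norm_nonneg β))
  rw [← h] at h2
  rcases (norm_nonneg (predictor φ β x)).eq_or_lt with h0 | h0
  · rw [← h0]; positivity
  · refine le_of_mul_le_mul_right ?_ h0
    linarith

lemma continuous_predictor [CompleteSpace 𝒴] (hφ : IsFeatureFamily φ κ)
    (x : 𝒳) : Continuous fun β => predictor φ β x :=
  (LinearMap.mkContinuous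
    { toFun := fun β => predictor φ β x
      map_add' := fun β β' => hφ.predictor_add β β' x
      map_smul' := fun c β => hφ.predictor_smul c β x } (√κ)
    fun β => hφ.norm_predictor_le β x : EllTwo Γ →L[ℝ] 𝒴).continuous

/-- The Gram matrix `⟪φ_γ(x), φ_γ'(x)⟫` as a square-summable family. -/
def gram (hφ : IsFeatureFamily φ κ) (x : 𝒳) : EllTwo (Γ × Γ) :=
  ⟨fun p => inner ℝ (φ p.1 x) (φ p.2 x), memℓp_two_of_summable_sq
    ((hφ.summable_norm_sq_mul x).of_nonneg_of_le (fun _ => sq_nonneg _)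
      fun p => inner_sq_le (φ p.1 x) _)⟩

lemma gram_apply (hφ : IsFeatureFamily φ κ)
    (x : 𝒳) (p : Γ × Γ) : hφ.gram x p = inner ℝ (φ p.1 x) (φ p.2 x) := rfl

lemma norm_gram_le (hφ : IsFeatureFamily φ κ) (x : 𝒳) : ‖hφ.gram x‖ ≤ κ := by
  have h0 := hφ.nonneg x
  refine norm_le_of_tsum_sq_le h0 ?_
  have hs := hφ.summable x
  calc ∑' p, hφ.gram x p ^ 2 ≤ ∑' p : Γ × Γ, ‖φ p.1 x‖ ^ 2 * ‖φ p.2 x‖ ^ 2 :=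
        (hasSum_sq _).summable.tsum_le_tsum (fun p => inner_sq_le (φ p.1 x) _)
          (hφ.summable_norm_sq_mul x)
    _ = (∑' γ, ‖φ γ x‖ ^ 2) * ∑' γ, ‖φ γ x‖ ^ 2 :=
        (tsum_mul_tsum_of_summable_norm hs.norm hs.norm).symm
    _ ≤ κ ^ 2 := by
        rw [sq]
        exact mul_le_mul (hφ.bound x) (hφ.bound x) (tsum_nonneg fun _ => sq_nonneg _) h0

/-- A quadratic form in `β` becomes a linear form in `β ⊗ β`, with coefficients depending on `x`
only. The deviation of empirical from population norms is thus controlled for all `β` by the norm of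
one averaged vector. -/
lemma norm_predictor_sq [CompleteSpace 𝒴] (hφ : IsFeatureFamily φ κ) (β : EllTwo Γ) (x : 𝒳) :
    ‖predictor φ β x‖ ^ 2 = inner ℝ (hφ.gram x) (tensorSq β) := by
  have h1 := lp.hasSum_inner (𝕜 := ℝ) (hφ.gram x) (tensorSq β)
  have h2 : ∀ γ, HasSum (fun γ' => inner ℝ (hφ.gram x (γ, γ')) (tensorSq β (γ, γ')))
      (β γ * inner ℝ (φ γ x) (predictor φ β x)) := fun γ => by
    refine hasSum_of_forall_eq (fun γ' => ?_)
      (((hφ.hasSum_predictor β x).mapL (innerSL ℝ (φ γ x))).mul_left (β γ))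
    simp [hφ.gram_apply, tensorSq_apply]
    ring
  have h3 := h1.prod_fiberwise h2
  have h4 := lp.hasSum_inner (𝕜 := ℝ) β (hφ.adjoint x (predictor φ β x))
  rw [← hφ.inner_predictor, real_inner_self_eq_norm_sq] at h4
  refine h4.unique ?_
  refine hasSum_of_forall_eq (fun γ => ?_) h3
  simp [hφ.adjoint_apply, mul_comm]

variable [Countable Γ] [SecondCountableTopology 𝒴] [BorelSpace 𝒴]

lemma stronglyMeasurable_gram (hφ : IsFeatureFamily φ κ) : StronglyMeasurable hφ.gram :=
  stronglyMeasurable_of_apply fun p => (hφ.measurable p.1).inner (hφ.measurable p.2)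

lemma stronglyMeasurable_adjoint (hφ : IsFeatureFamily φ κ)
    {A : Type*} [MeasurableSpace A] {X : A → 𝒳} {Y : A → 𝒴}
    (hX : Measurable X) (hY : Measurable Y) :
    StronglyMeasurable fun a => hφ.adjoint (X a) (Y a) :=
  stronglyMeasurable_of_apply fun γ => ((hφ.measurable γ).comp hX).inner hY

lemma measurable_predictor [CompleteSpace 𝒴] (hφ : IsFeatureFamily φ κ)
    (β : EllTwo Γ) : Measurable (predictor φ β) := by
  refine measurable_of_tendsto_metrizable' (atTop : Filter (Finset Γ))
    (f := fun s x => ∑ γ ∈ s, β γ • φ γ x) (fun s => ?_)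
    (tendsto_pi_nhds.2 fun x => hφ.hasSum_predictor β x)
  exact Finset.measurable_fun_sum _ fun γ _ => (hφ.measurable γ).const_smul _

end IsFeatureFamily

/-! ### Existence and uniqueness of the minimizer -/

lemma two_mul_ofReal (x : ℝ) : 2 * ENNReal.ofReal x = ENNReal.ofReal (2 * x) := by
  rw [ENNReal.ofReal_mul zero_le_two]
  simp

/-- The midpoint of two near-minimizers cannot go below the infimum, so they must be close to each
other. Minimizing sequences are therefore Cauchy, and lower semicontinuity passes the value to the
limit. -/
lemma existsUnique_forall_le_of_midpoint {E : Type*} [NormedAddCommGroup E] [NormedSpace ℝ E]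
    [CompleteSpace E] {F : E → ℝ≥0∞} (hF : LowerSemicontinuous F) (h0 : ∃ x, F x ≠ ∞) {c : ℝ}
    (hc : 0 < c)
    (hmid : ∀ a b, 2 * F ((1 / 2 : ℝ) • (a + b)) + ENNReal.ofReal (c * ‖a - b‖ ^ 2) ≤ F a + F b) :
    ∃! x, ∀ y, F x ≤ F y := by
  set m := ⨅ x, F x with hm
  have hm_top : m ≠ ∞ := by
    obtain ⟨x, hx⟩ := h0
    exact ne_top_of_le_ne_top hx (iInf_le F x)
  have key : ∀ (δ : ℝ), 0 ≤ δ → ∀ a b, F a ≤ m + ENNReal.ofReal δ → F b ≤ m + ENNReal.ofReal δ →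
      c * ‖a - b‖ ^ 2 ≤ 2 * δ := by
    intro δ hδ a b ha hb
    have h1 : 2 * m + ENNReal.ofReal (c * ‖a - b‖ ^ 2) ≤ 2 * m + ENNReal.ofReal (2 * δ) := by
      calc 2 * m + ENNReal.ofReal (c * ‖a - b‖ ^ 2)
          ≤ 2 * F ((1 / 2 : ℝ) • (a + b)) + ENNReal.ofReal (c * ‖a - b‖ ^ 2) := by
            gcongr; exact iInf_le F _
        _ ≤ F a + F b := hmid a b
        _ ≤ (m + ENNReal.ofReal δ) + (m + ENNReal.ofReal δ) := add_le_add ha hb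
        _ = 2 * m + ENNReal.ofReal (2 * δ) := by
            rw [two_mul δ, ENNReal.ofReal_add hδ hδ, two_mul]; ring
    have h2 := (ENNReal.add_le_add_iff_left (ENNReal.mul_ne_top (by simp) hm_top)).1 h1
    exact (ENNReal.ofReal_le_ofReal_iff (by positivity)).1 h2
  have hseq : ∀ n : ℕ, ∃ x, F x ≤ m + ENNReal.ofReal (1 / ((n : ℝ) + 1)) := fun n => by
    have hlt : m < m + ENNReal.ofReal (1 / ((n : ℝ) + 1)) :=
      ENNReal.lt_add_right hm_top (by simpa using Nat.cast_add_one_pos n)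
    obtain ⟨x, hx⟩ := iInf_lt_iff.1 hlt
    exact ⟨x, hx.le⟩
  choose u hu using hseq
  have hu_mono : ∀ N n : ℕ, N ≤ n → F (u n) ≤ m + ENNReal.ofReal (1 / ((N : ℝ) + 1)) :=
    fun N n hn => (hu n).trans (by gcongr)
  have hcauchy : CauchySeq u := by
    refine cauchySeq_of_le_tendsto_0 (fun N : ℕ => √(2 * (1 / ((N : ℝ) + 1)) / c))
      (fun k l N hk hl => ?_) ?_
    · rw [dist_eq_norm]
      refine Real.le_sqrt_of_sq_le ?_
      rw [le_div_iff₀ hc, mul_comm]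
      exact key _ (by positivity) _ _ (hu_mono N k hk) (hu_mono N l hl)
    · have h := ((tendsto_one_div_add_atTop_nhds_zero_nat (𝕜 := ℝ)).const_mul 2).div_const c
      simpa using h.sqrt
  obtain ⟨x, hx⟩ := cauchySeq_tendsto_of_complete hcauchy
  have hFx : F x ≤ m := by
    have h1 : Tendsto (fun n : ℕ => m + ENNReal.ofReal (1 / ((n : ℝ) + 1))) atTop (𝓝 m) := by
      have := (ENNReal.tendsto_ofReal
        (tendsto_one_div_add_atTop_nhds_zero_nat (𝕜 := ℝ))).const_add m
      simpa using this
    refine le_of_forall_lt fun r hr => ?_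
    have h2 := hx.eventually (hF x r hr)
    obtain ⟨r', hr1, hr2⟩ := exists_between hr
    have h3 := hx.eventually (hF x r' hr2)
    refine hr1.trans_le (ge_of_tendsto h1 ?_)
    filter_upwards [h3] with n hn using hn.le.trans (hu n)
  refine ⟨x, fun y => hFx.trans (iInf_le F y), fun y hy => ?_⟩
  have hFy : F y ≤ m := le_iInf hy
  -- Uniqueness is the case of zero slack.
  have h := key 0 le_rfl y x (by simpa using hFy) (by simpa using hFx)
  have h2 : ‖y - x‖ ^ 2 ≤ 0 := by
    by_contra h3
    push Not at h3
    nlinarith [mul_pos hc h3]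
  have h4 : ‖y - x‖ = 0 := by
    have := sq_nonneg ‖y - x‖
    exact pow_eq_zero_iff two_ne_zero |>.1 (le_antisymm h2 this)
  exact sub_eq_zero.1 (norm_eq_zero.1 h4)

section Penalty

variable {Γ : Type*} {w : Γ → ℝ} {ε : ℝ}

lemma ofReal_mul_norm_sq_eq_tsum {c : ℝ} (hc : 0 ≤ c) (β : EllTwo Γ) :
    ENNReal.ofReal (c * ‖β‖ ^ 2) = ∑' γ, ENNReal.ofReal (c * β γ ^ 2) := by
  have h := (hasSum_sq β).mul_left c
  rw [← h.tsum_eq, ENNReal.ofReal_tsum_of_nonneg (fun γ => by positivity) h.summable]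

lemma ofReal_mul_norm_sq_le_penalty (hw : ∀ γ, 0 ≤ w γ) (hε : 0 ≤ ε) (β : EllTwo Γ) :
    ENNReal.ofReal (ε * ‖β‖ ^ 2) ≤ penalty w ε β := by
  rw [ofReal_mul_norm_sq_eq_tsum hε]
  refine ENNReal.tsum_le_tsum fun γ => ENNReal.ofReal_le_ofReal ?_
  have := mul_nonneg (hw γ) (abs_nonneg (β γ))
  linarith

/-- The quadratic part satisfies the parallelogram identity, giving the gain; the weighted absolute
values are merely convex. -/
lemma penalty_midpoint (hw : ∀ γ, 0 ≤ w γ) (hε : 0 ≤ ε) (a b : EllTwo Γ) :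
    2 * penalty w ε ((1 / 2 : ℝ) • (a + b)) + ENNReal.ofReal (ε / 2 * ‖a - b‖ ^ 2)
      ≤ penalty w ε a + penalty w ε b := by
  rw [ofReal_mul_norm_sq_eq_tsum (by positivity), penalty, penalty, penalty,
    ← ENNReal.tsum_mul_left, ← ENNReal.tsum_add, ← ENNReal.tsum_add]
  refine ENNReal.tsum_le_tsum fun γ => ?_
  have hwγ := hw γ
  rw [two_mul_ofReal, ← ENNReal.ofReal_add (by positivity) (by positivity),
    ← ENNReal.ofReal_add (by positivity) (by positivity)]
  refine ENNReal.ofReal_le_ofReal ?_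
  simp only [lp.coeFn_smul, lp.coeFn_add, lp.coeFn_sub, Pi.smul_apply, Pi.add_apply,
    Pi.sub_apply, smul_eq_mul, abs_mul]
  rw [abs_of_pos (by norm_num : (0 : ℝ) < 1 / 2)]
  nlinarith [mul_le_mul_of_nonneg_left (abs_add_le (a γ) (b γ)) hwγ]

lemma lowerSemicontinuous_penalty : LowerSemicontinuous (penalty (Γ := Γ) w ε) := by
  refine lowerSemicontinuous_tsum fun γ => Continuous.lowerSemicontinuous ?_
  have h : Continuous fun β : EllTwo Γ => β γ :=
    (lp.evalCLM ℝ (fun _ : Γ => ℝ) 2 γ).continuous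
  exact ENNReal.continuous_ofReal.comp
    ((h.abs.const_mul (w γ)).add ((h.pow 2).const_mul ε))

lemma penalty_zero : penalty w ε (0 : EllTwo Γ) = 0 := by simp [penalty]

lemma penalty_add_ne_top (hw : ∀ γ, 0 ≤ w γ) (hε : 0 ≤ ε) {a b : EllTwo Γ}
    (ha : penalty w ε a ≠ ∞) (hb : penalty w ε b ≠ ∞) : penalty w ε (a + b) ≠ ∞ := by
  refine ne_top_of_le_ne_top (b := 2 * (penalty w ε a + penalty w ε b))
    (ENNReal.mul_ne_top (by simp) (ENNReal.add_ne_top.2 ⟨ha, hb⟩)) ?_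
  rw [penalty, penalty, penalty, ← ENNReal.tsum_add, ← ENNReal.tsum_mul_left]
  refine ENNReal.tsum_le_tsum fun γ => ?_
  have hwγ := hw γ
  rw [← ENNReal.ofReal_add (by positivity) (by positivity),
    two_mul_ofReal]
  refine ENNReal.ofReal_le_ofReal ?_
  simp only [lp.coeFn_add, Pi.add_apply]
  nlinarith [mul_le_mul_of_nonneg_left (abs_add_le (a γ) (b γ)) hwγ,
    mul_nonneg hwγ (abs_nonneg (a γ)), mul_nonneg hwγ (abs_nonneg (b γ)),
    mul_nonneg hε (sq_nonneg (a γ - b γ))]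

lemma penalty_smul_ne_top (hw : ∀ γ, 0 ≤ w γ) (hε : 0 ≤ ε) (c : ℝ) {a : EllTwo Γ}
    (ha : penalty w ε a ≠ ∞) : penalty w ε (c • a) ≠ ∞ := by
  refine ne_top_of_le_ne_top (b := ENNReal.ofReal (|c| + c ^ 2) * penalty w ε a)
    (ENNReal.mul_ne_top (by simp) ha) ?_
  rw [penalty, penalty, ← ENNReal.tsum_mul_left]
  refine ENNReal.tsum_le_tsum fun γ => ?_
  rw [← ENNReal.ofReal_mul (by positivity)]
  refine ENNReal.ofReal_le_ofReal ?_
  simp only [lp.coeFn_smul, Pi.smul_apply, smul_eq_mul, abs_mul]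
  have h1 := mul_nonneg (sq_nonneg c) (mul_nonneg (hw γ) (abs_nonneg (a γ)))
  have h2 := mul_nonneg (abs_nonneg c) (mul_nonneg hε (sq_nonneg (a γ)))
  nlinarith

lemma penalty_single_ne_top [DecidableEq Γ] (γ : Γ) :
    penalty w ε (lp.single (E := fun _ : Γ => ℝ) 2 γ (1 : ℝ)) ≠ ∞ := by
  rw [penalty, tsum_eq_single γ fun γ' h => by
    rw [lp.single_apply_ne (E := fun _ : Γ => ℝ) 2 γ (1 : ℝ) h]; simp]
  exact ENNReal.ofReal_ne_top

end Penalty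

lemma norm_sub_midpoint_sq_le {𝒴 : Type*} [NormedAddCommGroup 𝒴] [InnerProductSpace ℝ 𝒴]
    (y u v : 𝒴) :
    2 * ‖y - (1 / 2 : ℝ) • (u + v)‖ ^ 2 ≤ ‖y - u‖ ^ 2 + ‖y - v‖ ^ 2 := by
  have h : y - (1 / 2 : ℝ) • (u + v) = (1 / 2 : ℝ) • ((y - u) + (y - v)) := by
    module
  have h2 := parallelogram_law_with_norm ℝ (y - u) (y - v)
  rw [h, norm_smul, mul_pow]
  norm_num
  nlinarith [sq_nonneg ‖y - u - (y - v)‖]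

section Existence

variable {Γ 𝒳 𝒴 : Type*} [MeasurableSpace 𝒳] [NormedAddCommGroup 𝒴] [InnerProductSpace ℝ 𝒴]
  [CompleteSpace 𝒴] [MeasurableSpace 𝒴] {φ : Γ → 𝒳 → 𝒴} {κ : ℝ} {w : Γ → ℝ} {ε : ℝ}

lemma IsFeatureFamily.lowerSemicontinuous_empiricalFunctional (hφ : IsFeatureFamily φ κ)
    (lam : ℝ) {n : ℕ} (s : Fin n → 𝒳 × 𝒴) :
    LowerSemicontinuous (empiricalFunctional φ w ε lam s) := by
  refine LowerSemicontinuous.add (Continuous.lowerSemicontinuous ?_) ?_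
  · have h : ∀ x, Continuous fun β => predictor φ β x := hφ.continuous_predictor
    exact ENNReal.continuous_ofReal.comp (by fun_prop)
  · refine (ENNReal.continuous_const_mul ENNReal.ofReal_ne_top).comp_lowerSemicontinuous
      lowerSemicontinuous_penalty fun a b h => by dsimp only; gcongr

/-- The elastic-net functional has exactly one minimizer over `ℓ₂`. -/
theorem IsFeatureFamily.existsUnique_isElasticNetEstimator (hφ : IsFeatureFamily φ κ)
    (hw : ∀ γ, 0 ≤ w γ) (hε : 0 < ε) {lam : ℝ} (hlam : 0 < lam) {n : ℕ} (s : Fin n → 𝒳 × 𝒴) :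
    ∃! β : EllTwo Γ, IsElasticNetEstimator φ w ε lam s β := by
  -- All the uniform convexity comes from the ridge term; the data term is only midpoint convex.
  refine existsUnique_forall_le_of_midpoint (c := lam * (ε / 2))
    (hφ.lowerSemicontinuous_empiricalFunctional lam s) ⟨0, ?_⟩ (by positivity) fun a b => ?_
  · rw [empiricalFunctional, penalty_zero, mul_zero, add_zero]
    exact ENNReal.ofReal_ne_top
  · set R : EllTwo Γ → ℝ := fun β => (1 / (n : ℝ)) * ∑ i, ‖(s i).2 - predictor φ β (s i).1‖ ^ 2
    have hR0 : ∀ β, 0 ≤ R β := fun β => by positivity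
    have hR : 2 * R ((1 / 2 : ℝ) • (a + b)) ≤ R a + R b := by
      simp only [R]
      rw [← mul_add, ← Finset.sum_add_distrib, mul_left_comm, Finset.mul_sum]
      gcongr with i
      rw [hφ.predictor_smul, hφ.predictor_add]
      exact norm_sub_midpoint_sq_le _ _ _
    have hR' : 2 * ENNReal.ofReal (R ((1 / 2 : ℝ) • (a + b))) ≤
        ENNReal.ofReal (R a) + ENNReal.ofReal (R b) := by
      rw [← ENNReal.ofReal_add (hR0 a) (hR0 b), two_mul_ofReal]
      exact ENNReal.ofReal_le_ofReal hR
    have hp := mul_le_mul_right (penalty_midpoint hw hε.le a b) (ENNReal.ofReal lam)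
    rw [mul_add, mul_add, ← ENNReal.ofReal_mul hlam.le, ← mul_assoc lam] at hp
    calc _ = 2 * ENNReal.ofReal (R ((1 / 2 : ℝ) • (a + b)))
          + (ENNReal.ofReal lam * (2 * penalty w ε ((1 / 2 : ℝ) • (a + b)))
            + ENNReal.ofReal (lam * (ε / 2) * ‖a - b‖ ^ 2)) := by
          simp only [empiricalFunctional, R]; ring
      _ ≤ _ := add_le_add hR' hp
      _ = _ := by simp only [empiricalFunctional, R]; ring

end Existence

/-! ### The basic inequality -/

/-- Recentring at `f` cancels the squared noise, which then enters only linearly. -/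
lemma norm_sub_sq_sub_norm_sub_sq {𝒴 : Type*} [NormedAddCommGroup 𝒴] [InnerProductSpace ℝ 𝒴]
    (y f u v : 𝒴) :
    ‖y - u‖ ^ 2 - ‖y - v‖ ^ 2 = ‖u - f‖ ^ 2 - ‖v - f‖ ^ 2 - 2 * inner ℝ (u - v) (y - f) := by
  have h1 : y - u = (y - f) - (u - f) := by abel
  have h2 : y - v = (y - f) - (v - f) := by abel
  have h3 : u - v = (u - f) - (v - f) := by abel
  rw [h1, h2, h3, norm_sub_sq_real (y - f) (u - f), norm_sub_sq_real (y - f) (v - f),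
    inner_sub_left (u - f),
    real_inner_comm (u - f) (y - f), real_inner_comm (v - f) (y - f)]
  ring

/-- On the side of the minimizer only the ridge part of the penalty is kept. -/
lemma IsElasticNetEstimator.risk_le {Γ 𝒳 𝒴 : Type*} [NormedAddCommGroup 𝒴] [NormedSpace ℝ 𝒴]
    {φ : Γ → 𝒳 → 𝒴} {w : Γ → ℝ} {ε lam : ℝ} {n : ℕ} {s : Fin n → 𝒳 × 𝒴} {β : EllTwo Γ}
    (hβ : IsElasticNetEstimator φ w ε lam s β)
    (hw : ∀ γ, 0 ≤ w γ) (hε : 0 < ε) (hlam : 0 < lam) {β₀ : EllTwo Γ}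
    (h0 : penalty w ε β₀ ≠ ∞) :
    (1 / (n : ℝ)) * ∑ i, ‖(s i).2 - predictor φ β (s i).1‖ ^ 2 + lam * (ε * ‖β‖ ^ 2) ≤
      (1 / (n : ℝ)) * ∑ i, ‖(s i).2 - predictor φ β₀ (s i).1‖ ^ 2
        + lam * (penalty w ε β₀).toReal := by
  have h1 := hβ β₀
  rw [empiricalFunctional, empiricalFunctional] at h1
  have h2 := (add_le_add_right (mul_le_mul_right (ofReal_mul_norm_sq_le_penalty hw hε.le β)
    (ENNReal.ofReal lam)) _).trans h1
  rw [← ENNReal.ofReal_toReal h0, ← ENNReal.ofReal_mul hlam.le, ← ENNReal.ofReal_mul hlam.le,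
    ← ENNReal.ofReal_add (by positivity) (by positivity),
    ← ENNReal.ofReal_add (by positivity) (by positivity)] at h2
  exact (ENNReal.ofReal_le_ofReal_iff (by positivity)).1 h2

lemma integral_fst_eq {𝒳 𝒴 : Type*} [MeasurableSpace 𝒳] [MeasurableSpace 𝒴]
    {P : Measure (𝒳 × 𝒴)} (g : 𝒳 → ℝ) (hg : Measurable g) :
    ∫ z, g z.1 ∂P = ∫ x, g x ∂P.fst := by
  rw [Measure.fst, integral_map measurable_fst.aemeasurable hg.aestronglyMeasurable]

section BasicInequality

variable {Γ 𝒳 𝒴 : Type*} [MeasurableSpace 𝒳] [NormedAddCommGroup 𝒴] [InnerProductSpace ℝ 𝒴]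
  [CompleteSpace 𝒴] [MeasurableSpace 𝒴] {φ : Γ → 𝒳 → 𝒴} {κ : ℝ} {w : Γ → ℝ} {ε lam : ℝ}
  {n : ℕ} {s : Fin n → 𝒳 × 𝒴} {β : EllTwo Γ}

/-- The error of an elastic-net estimator in the norm of the sample and in `ℓ₂`, relative to an
arbitrary `β₀` of finite penalty. -/
lemma IsElasticNetEstimator.empirical_error_le (hβ : IsElasticNetEstimator φ w ε lam s β)
    (hφ : IsFeatureFamily φ κ) (hw : ∀ γ, 0 ≤ w γ) (hε : 0 < ε) (hlam : 0 < lam)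
    {β₀ : EllTwo Γ} (h0 : penalty w ε β₀ ≠ ∞) (f : 𝒳 → 𝒴) {C : ℝ}
    (hG : ‖(1 / (n : ℝ)) • ∑ i, hφ.adjoint (s i).1 ((s i).2 - f (s i).1)‖ ≤ C * lam) :
    (1 / (n : ℝ)) * ∑ i, ‖predictor φ β (s i).1 - f (s i).1‖ ^ 2
        + lam * (ε / 4 * ‖β - β₀‖ ^ 2) ≤
      (1 / (n : ℝ)) * ∑ i, ‖predictor φ β₀ (s i).1 - f (s i).1‖ ^ 2
        + lam * ((penalty w ε β₀).toReal + ε * ‖β₀‖ ^ 2 + 4 * C ^ 2 / ε) := by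
  have h1 := hβ.risk_le hw hε hlam h0
  set G := (1 / (n : ℝ)) • ∑ i, hφ.adjoint (s i).1 ((s i).2 - f (s i).1) with hGdef
  have h2 : (1 / (n : ℝ)) * ∑ i, ‖(s i).2 - predictor φ β (s i).1‖ ^ 2
      - (1 / (n : ℝ)) * ∑ i, ‖(s i).2 - predictor φ β₀ (s i).1‖ ^ 2
      = (1 / (n : ℝ)) * ∑ i, ‖predictor φ β (s i).1 - f (s i).1‖ ^ 2
        - (1 / (n : ℝ)) * ∑ i, ‖predictor φ β₀ (s i).1 - f (s i).1‖ ^ 2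
        - 2 * inner ℝ (β - β₀) G := by
    have hin : inner ℝ (β - β₀) G = (1 / (n : ℝ)) * ∑ i,
        inner ℝ (predictor φ β (s i).1 - predictor φ β₀ (s i).1) ((s i).2 - f (s i).1) := by
      rw [hGdef, real_inner_smul_right, inner_sum]
      simp only [← hφ.inner_predictor, hφ.predictor_sub]
    rw [hin, ← mul_sub, ← mul_sub, mul_left_comm 2, ← mul_sub, Finset.mul_sum,
      ← Finset.sum_sub_distrib, ← Finset.sum_sub_distrib, ← Finset.sum_sub_distrib]
    congr 1
    exact Finset.sum_congr rfl fun i _ => norm_sub_sq_sub_norm_sub_sq _ _ _ _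
  set d := ‖β - β₀‖ with hd
  have h3 : inner ℝ (β - β₀) G ≤ d * (C * lam) :=
    (real_inner_le_norm _ _).trans (mul_le_mul_of_nonneg_left hG (norm_nonneg _))
  -- The ridge term is thus at least `ε / 2 * d ^ 2 - ε * ‖β₀‖ ^ 2`. The Young inequality `h7`
  -- spends half of the `d ^ 2` part on the noise, and `ε / 4` remains.
  have h4 : d ^ 2 ≤ 2 * ‖β‖ ^ 2 + 2 * ‖β₀‖ ^ 2 := by
    have h5 : d ≤ ‖β‖ + ‖β₀‖ := norm_sub_le _ _
    have h6 : 0 ≤ d := norm_nonneg _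
    nlinarith [sq_nonneg (‖β‖ - ‖β₀‖), norm_nonneg β, norm_nonneg β₀]
  have h7 : 2 * C * d ≤ ε / 4 * d ^ 2 + 4 * C ^ 2 / ε := by
    have h8 : ε / 4 * d ^ 2 + 4 * C ^ 2 / ε - 2 * C * d = (ε * d - 4 * C) ^ 2 / (4 * ε) := by
      field_simp
      ring
    have h9 : 0 ≤ (ε * d - 4 * C) ^ 2 / (4 * ε) := by positivity
    linarith
  have h10 := mul_le_mul_of_nonneg_left h7 hlam.le
  have h11 := mul_le_mul_of_nonneg_left h4 (mul_pos hlam hε).le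
  nlinarith

/-- The population norm of `f_β - f_β₀`, with Gram matrix `M`, is controlled by the empirical
error of `β₀`. -/
lemma IsElasticNetEstimator.inner_tensorSq_le (hβ : IsElasticNetEstimator φ w ε lam s β)
    (hφ : IsFeatureFamily φ κ) (hw : ∀ γ, 0 ≤ w γ) (hε : 0 < ε) (hlam : 0 < lam) (hn : 1 ≤ n)
    {β₀ : EllTwo Γ} (h0 : penalty w ε β₀ ≠ ∞) (f : 𝒳 → 𝒴) {C C' : ℝ} (hC' : 0 ≤ C')
    (hG : ‖(1 / (n : ℝ)) • ∑ i, hφ.adjoint (s i).1 ((s i).2 - f (s i).1)‖ ≤ C * lam)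
    {M : EllTwo (Γ × Γ)}
    (hK : ‖(1 / (n : ℝ)) • ∑ i, (hφ.gram (s i).1 - M)‖ ≤ C' * lam) :
    inner ℝ M (tensorSq (β - β₀)) ≤ (4 + 4 * C' / ε) *
      ((1 / (n : ℝ)) * ∑ i, ‖predictor φ β₀ (s i).1 - f (s i).1‖ ^ 2
        + lam * ((penalty w ε β₀).toReal + ε * ‖β₀‖ ^ 2 + 4 * C ^ 2 / ε)) := by
  have h1 := hβ.empirical_error_le hφ hw hε hlam h0 f hG
  have hn0 : (n : ℝ) ≠ 0 := by exact_mod_cast (by omega : n ≠ 0)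
  set K := (1 / (n : ℝ)) • ∑ i, (hφ.gram (s i).1 - M) with hKdef
  set a := (1 / (n : ℝ)) * ∑ i, ‖predictor φ β (s i).1 - f (s i).1‖ ^ 2 with ha
  set e := (1 / (n : ℝ)) * ∑ i, ‖predictor φ β₀ (s i).1 - f (s i).1‖ ^ 2 with he
  set D := (penalty w ε β₀).toReal + ε * ‖β₀‖ ^ 2 + 4 * C ^ 2 / ε with hD
  set Δ := β - β₀ with hΔ
  have ha0 : 0 ≤ a := by positivity
  have he0 : 0 ≤ e := by positivity
  have hD0 : 0 ≤ D := by positivity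
  have h2 : inner ℝ K (tensorSq Δ) =
      (1 / (n : ℝ)) * ∑ i, ‖predictor φ Δ (s i).1‖ ^ 2 - inner ℝ M (tensorSq Δ) := by
    rw [hKdef, real_inner_smul_left, sum_inner]
    simp only [inner_sub_left, ← hφ.norm_predictor_sq]
    rw [Finset.sum_sub_distrib, mul_sub]
    congr 1
    simp [hn0]
  have h3 : (1 / (n : ℝ)) * ∑ i, ‖predictor φ Δ (s i).1‖ ^ 2 ≤ 2 * a + 2 * e := by
    rw [ha, he, mul_left_comm 2, mul_left_comm 2, ← mul_add, Finset.mul_sum _ _ 2, Finset.mul_sum _ _ 2,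
      ← Finset.sum_add_distrib]
    gcongr with i
    rw [hΔ, hφ.predictor_sub, ← sub_sub_sub_cancel_right _ _ (f (s i).1)]
    have h4 := norm_sub_le (predictor φ β (s i).1 - f (s i).1)
      (predictor φ β₀ (s i).1 - f (s i).1)
    nlinarith [norm_nonneg (predictor φ β (s i).1 - f (s i).1 -
      (predictor φ β₀ (s i).1 - f (s i).1)), norm_nonneg (predictor φ β (s i).1 - f (s i).1),
      norm_nonneg (predictor φ β₀ (s i).1 - f (s i).1),
      sq_nonneg (‖predictor φ β (s i).1 - f (s i).1‖ - ‖predictor φ β₀ (s i).1 - f (s i).1‖)]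
  have h5 : -(C' * lam * ‖Δ‖ ^ 2) ≤ inner ℝ K (tensorSq Δ) := by
    have h6 : |inner ℝ K (tensorSq Δ)| ≤ C' * lam * ‖Δ‖ ^ 2 :=
      (abs_real_inner_le_norm _ _).trans
        (mul_le_mul hK (norm_tensorSq_le Δ) (norm_nonneg _) (by positivity))
    exact (abs_le.1 h6).1
  -- The same inequality that bounds the empirical error bounds `lam * ‖Δ‖ ^ 2`, so the Gram
  -- deviation costs `4 * C' / ε` times its right-hand side. The other summand `4` comes from `2 * a
  -- + 2 * e` with `a ≤ e + lam * D`.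
  have h7 : lam * ‖Δ‖ ^ 2 ≤ 4 / ε * (e + lam * D) := by
    rw [div_mul_eq_mul_div, le_div_iff₀ hε]
    nlinarith
  have h8 := mul_le_mul_of_nonneg_left h7 hC'
  have h9 : 0 ≤ lam * (ε / 4 * ‖Δ‖ ^ 2) := by positivity
  have h10 : 0 ≤ lam * D := by positivity
  have h11 : C' * (4 / ε * (e + lam * D)) = 4 * C' / ε * (e + lam * D) := by ring
  rw [add_mul]
  linarith

end BasicInequality

/-! ### Approximation by the span and population moments -/

section Population

variable {Γ 𝒳 𝒴 : Type*} [MeasurableSpace 𝒳] [NormedAddCommGroup 𝒴] [InnerProductSpace ℝ 𝒴]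
  [MeasurableSpace 𝒴] {φ : Γ → 𝒳 → 𝒴} {κ : ℝ} {f : 𝒳 → 𝒴} {C : ℝ}
  {P : Measure (𝒳 × 𝒴)} [IsProbabilityMeasure P] {σ L : ℝ}

section Measurability

variable [SecondCountableTopology 𝒴] [BorelSpace 𝒴] [Countable Γ]

lemma IsFeatureFamily.stronglyMeasurable_adjoint_noise (hφ : IsFeatureFamily φ κ)
    (hf : Measurable f) :
    StronglyMeasurable fun z : 𝒳 × 𝒴 => hφ.adjoint z.1 (z.2 - f z.1) :=
  hφ.stronglyMeasurable_adjoint measurable_fst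
    (measurable_snd.sub (hf.comp measurable_fst))

lemma IsFeatureFamily.integrable_gram (hφ : IsFeatureFamily φ κ) :
    Integrable (fun z : 𝒳 × 𝒴 => hφ.gram z.1) P :=
  Integrable.of_bound (hφ.stronglyMeasurable_gram.comp_measurable
    measurable_fst).aestronglyMeasurable κ (ae_of_all _ fun z => hφ.norm_gram_le z.1)

end Measurability

variable [CompleteSpace 𝒴]

lemma IsFeatureFamily.norm_predictor_sub_le (hφ : IsFeatureFamily φ κ) (hC : ∀ x, ‖f x‖ ≤ C)
    (β : EllTwo Γ) (x : 𝒳) : ‖predictor φ β x - f x‖ ≤ √κ * ‖β‖ + C :=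
  (norm_sub_le _ _).trans (add_le_add (hφ.norm_predictor_le β x) (hC x))

/-- Single features have finite penalty, and finiteness survives sums and scalar multiples, so every
element of the span is an admissible comparison. -/
lemma IsFeatureFamily.exists_ae_eq_predictor (hφ : IsFeatureFamily φ κ) {w : Γ → ℝ}
    (hw : ∀ γ, 0 ≤ w γ) {ε : ℝ} (hε : 0 ≤ ε) {ν : Measure 𝒳} {g : Lp 𝒴 2 ν}
    (hg : g ∈ Submodule.span ℝ {g : Lp 𝒴 2 ν | ∃ γ, (g : 𝒳 → 𝒴) =ᵐ[ν] φ γ}) :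
    ∃ β : EllTwo Γ, penalty w ε β ≠ ∞ ∧ (g : 𝒳 → 𝒴) =ᵐ[ν] predictor φ β := by
  classical
  induction hg using Submodule.span_induction with
  | mem g hg =>
    obtain ⟨γ, hγ⟩ := hg
    refine ⟨lp.single (E := fun _ : Γ => ℝ) 2 γ (1 : ℝ), penalty_single_ne_top γ, ?_⟩
    filter_upwards [hγ] with x hx
    rw [hx, predictor, tsum_eq_single γ fun γ' h => by
      rw [lp.single_apply_ne (E := fun _ : Γ => ℝ) 2 γ (1 : ℝ) h, zero_smul],
      lp.single_apply_self, one_smul]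
  | zero =>
    refine ⟨0, by simp [penalty_zero], ?_⟩
    filter_upwards [Lp.coeFn_zero 𝒴 2 ν] with x hx
    rw [hx]
    simp [predictor]
  | add g g' _ _ ih ih' =>
    obtain ⟨β, hβ, h⟩ := ih
    obtain ⟨β', hβ', h'⟩ := ih'
    refine ⟨β + β', penalty_add_ne_top hw hε hβ hβ', ?_⟩
    filter_upwards [Lp.coeFn_add g g', h, h'] with x hx h1 h2
    rw [hx, Pi.add_apply, h1, h2, hφ.predictor_add]
  | smul c g _ ih =>
    obtain ⟨β, hβ, h⟩ := ih
    refine ⟨c • β, penalty_smul_ne_top hw hε c hβ, ?_⟩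
    filter_upwards [Lp.coeFn_smul c g, h] with x hx h1
    rw [hx, Pi.smul_apply, h1, hφ.predictor_smul]

lemma IsNoise.integrable_exp_norm (hN : IsNoise P f σ L) :
    Integrable (fun z => Real.exp (‖z.2 - f z.1‖ / L)) P := by
  refine ((hN.integrable_exp.add (hN.integrable.norm.div_const L)).add
    (integrable_const 1)).congr (ae_of_all _ fun z => ?_)
  simp only [Pi.add_apply]
  ring

variable [SecondCountableTopology 𝒴] [BorelSpace 𝒴]

lemma SpanDense.exists_integral_le {ν : Measure 𝒳} [IsFiniteMeasure ν] (hd : SpanDense φ ν)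
    (hφ : IsFeatureFamily φ κ) {w : Γ → ℝ} (hw : ∀ γ, 0 ≤ w γ) {ε : ℝ} (hε : 0 ≤ ε)
    (hf : Measurable f) (hC : ∀ x, ‖f x‖ ≤ C) {η : ℝ} (hη : 0 < η) :
    ∃ β : EllTwo Γ, penalty w ε β ≠ ∞ ∧ ∫ x, ‖predictor φ β x - f x‖ ^ 2 ∂ν ≤ η := by
  have hfL : MemLp f 2 ν := MemLp.of_bound hf.aestronglyMeasurable C (ae_of_all _ hC)
  obtain ⟨g, hg, hdist⟩ := hd.exists_dist_lt hfL.toLp (Real.sqrt_pos.2 hη)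
  obtain ⟨β, hβ, hgβ⟩ := hφ.exists_ae_eq_predictor hw hε hg
  refine ⟨β, hβ, ?_⟩
  have h1 : ∫ x, ‖predictor φ β x - f x‖ ^ 2 ∂ν = ‖g - hfL.toLp‖ ^ 2 := by
    rw [← real_inner_self_eq_norm_sq, L2.inner_def]
    refine integral_congr_ae ?_
    filter_upwards [Lp.coeFn_sub g hfL.toLp, hgβ, hfL.coeFn_toLp] with x h2 h3 h4
    rw [h2, Pi.sub_apply, h3, h4, real_inner_self_eq_norm_sq]
  rw [h1, ← dist_eq_norm, dist_comm, ← Real.sq_sqrt hη.le]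
  exact pow_le_pow_left₀ dist_nonneg hdist.le 2

/-- The feature is measurable with respect to the first coordinate, so it pulls out of the
conditional expectation of the noise, which vanishes. -/
lemma IsNoise.integral_inner_eq_zero (hN : IsNoise P f σ L) (hφ : IsFeatureFamily φ κ) (γ : Γ)
    (hint : Integrable (fun z => inner ℝ (φ γ z.1) (z.2 - f z.1)) P) :
    ∫ z, inner ℝ (φ γ z.1) (z.2 - f z.1) ∂P = 0 := by
  set m : MeasurableSpace (𝒳 × 𝒴) := MeasurableSpace.comap Prod.fst inferInstance with hm
  have hle : m ≤ Prod.instMeasurableSpace := measurable_fst.comap_le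
  have hφm : StronglyMeasurable[m] fun z : 𝒳 × 𝒴 => φ γ z.1 :=
    ((hφ.measurable γ).comp (comap_measurable Prod.fst)).stronglyMeasurable
  have h := condExp_bilin_of_stronglyMeasurable_left (m := m)
    (innerSL ℝ : 𝒴 →L[ℝ] 𝒴 →L[ℝ] ℝ) hφm hint hN.integrable
  rw [← integral_condExp hle]
  refine (integral_congr_ae (h.trans ?_)).trans (integral_zero _ ℝ)
  filter_upwards [hN.zero_mean] with z hz
  rw [hz]
  simp

variable [Countable Γ]

lemma IsFeatureFamily.integrable_norm_predictor_sub_sq (hφ : IsFeatureFamily φ κ)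
    (hf : Measurable f) (hC : ∀ x, ‖f x‖ ≤ C) (ν : Measure 𝒳) [IsFiniteMeasure ν]
    (β : EllTwo Γ) : Integrable (fun x => ‖predictor φ β x - f x‖ ^ 2) ν := by
  refine Integrable.of_bound (((hφ.measurable_predictor β).sub hf).norm.pow_const 2
    |>.aestronglyMeasurable) ((√κ * ‖β‖ + C) ^ 2) (ae_of_all _ fun x => ?_)
  rw [norm_pow, norm_norm]
  exact pow_le_pow_left₀ (norm_nonneg _) (hφ.norm_predictor_sub_le hC β x) 2

lemma IsFeatureFamily.predictionError_eq (hφ : IsFeatureFamily φ κ) (hf : Measurable f)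
    (hC : ∀ x, ‖f x‖ ≤ C) (β : EllTwo Γ) :
    predictionError φ P f β = ENNReal.ofReal (∫ x, ‖predictor φ β x - f x‖ ^ 2 ∂P.fst) := by
  have hm : Measurable fun x => ‖predictor φ β x - f x‖ ^ 2 :=
    ((hφ.measurable_predictor β).sub hf).norm.pow_const 2
  rw [ofReal_integral_eq_lintegral_ofReal (hφ.integrable_norm_predictor_sub_sq hf hC _ β)
    (ae_of_all _ fun x => by positivity), Measure.fst,
    lintegral_map hm.ennreal_ofReal measurable_fst, predictionError]
  refine lintegral_congr fun z => ?_
  rw [ENNReal.ofReal_pow (norm_nonneg _), ofReal_norm]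

lemma IsNoise.integral_adjoint_eq_zero (hN : IsNoise P f σ L) (hφ : IsFeatureFamily φ κ)
    (hf : Measurable f) : ∫ z, hφ.adjoint z.1 (z.2 - f z.1) ∂P = 0 := by
  have hi : Integrable (fun z => hφ.adjoint z.1 (z.2 - f z.1)) P :=
    (hN.integrable.norm.const_mul √κ).mono'
      (hφ.stronglyMeasurable_adjoint_noise hf).aestronglyMeasurable
      (ae_of_all _ fun z => hφ.norm_adjoint_le _ _)
  refine lp.ext (funext fun γ => ?_)
  have h := (lp.evalCLM ℝ (fun _ : Γ => ℝ) 2 γ).integral_comp_comm hi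
  exact h.symm.trans (hN.integral_inner_eq_zero hφ γ
    ((lp.evalCLM ℝ (fun _ : Γ => ℝ) 2 γ).integrable_comp hi))

lemma IsNoise.integrable_exp_norm_adjoint (hN : IsNoise P f σ L) (hL : 0 < L)
    (hφ : IsFeatureFamily φ κ) (hf : Measurable f) :
    Integrable (fun z => Real.exp (1 / (L * (√κ + 1)) * ‖hφ.adjoint z.1 (z.2 - f z.1)‖)) P := by
  refine hN.integrable_exp_norm.mono' ((Real.measurable_exp.comp
    ((hφ.stronglyMeasurable_adjoint_noise hf).norm.measurable.const_mul
      _)).aestronglyMeasurable) (ae_of_all _ fun z => ?_)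
  rw [Real.norm_of_nonneg (Real.exp_pos _).le]
  refine Real.exp_le_exp.2 ?_
  -- The `+ 1` in the scale keeps the denominator positive when `κ = 0`.
  rw [one_div_mul_eq_div, div_le_div_iff₀ (by positivity) hL]
  have h1 := hφ.norm_adjoint_le z.1 (z.2 - f z.1)
  have h2 := norm_nonneg (z.2 - f z.1)
  nlinarith [mul_le_mul_of_nonneg_right h1 hL.le, mul_nonneg h2 hL.le]

lemma IsFeatureFamily.inner_integral_gram (hφ : IsFeatureFamily φ κ) (β : EllTwo Γ) :
    inner ℝ (∫ z, hφ.gram z.1 ∂P) (tensorSq β) = ∫ x, ‖predictor φ β x‖ ^ 2 ∂P.fst := by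
  rw [← integral_fst_eq _ ((hφ.measurable_predictor β).norm.pow_const 2), real_inner_comm,
    ← integral_inner hφ.integrable_gram]
  refine integral_congr_ae (ae_of_all _ fun z => ?_)
  simp only [hφ.norm_predictor_sq]
  exact real_inner_comm _ _

end Population

/-! ### Almost sure rates and limits -/

/-- The limsup is at most `(A + 2) * η` for each `j`; it is essential that `A` does not depend on
`j`. -/
lemma tendsto_ofReal_zero_of_eventually_le {u : ℕ → ℝ} {A : ℝ} (hA : 0 ≤ A)
    (h : ∀ j : ℕ, ∃ (η : ℝ) (v : ℕ → ℝ), η ≤ 1 / ((j : ℝ) + 1) ∧ Tendsto v atTop (𝓝 η) ∧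
      ∀ᶠ n in atTop, u n ≤ A * v n + 2 * η) :
    Tendsto (fun n => ENNReal.ofReal (u n)) atTop (𝓝 0) := by
  rw [ENNReal.tendsto_nhds_zero]
  intro δ hδ
  obtain ⟨r, hr0, hrδ⟩ := ENNReal.lt_iff_exists_real_btwn.1 hδ
  obtain ⟨hr0', hr⟩ := hrδ
  have hrpos : 0 < r := by simpa using hr0'
  obtain ⟨j, hj⟩ := exists_nat_one_div_lt (show 0 < r / (A + 2) by positivity)
  obtain ⟨η, v, hη, hv, hu⟩ := h j
  have hlim : Tendsto (fun n => A * v n + 2 * η) atTop (𝓝 (A * η + 2 * η)) :=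
    (hv.const_mul A).add_const _
  have hlt : A * η + 2 * η < r := by
    rw [← add_mul, mul_comm]
    exact (lt_div_iff₀ (by positivity)).1 (hη.trans_lt hj)
  filter_upwards [hu, hlim.eventually (gt_mem_nhds hlt)] with n h1 h2
  exact (ENNReal.ofReal_le_ofReal (h1.trans h2.le)).trans hr.le

/-- Of the rate condition, only `n * lam n ^ 2 ≥ log n` for large `n` is needed. -/
lemma eventually_sqrt_mul_log_le {lam : ℕ → ℝ} (hlam : ∀ n, 1 ≤ n → 0 < lam n)
    (hrate : Tendsto (fun n : ℕ => (n : ℝ) * lam n ^ 2 - 2 * Real.log n) atTop atTop) :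
    ∀ᶠ n : ℕ in atTop, √(n * Real.log n) ≤ n * lam n := by
  filter_upwards [hrate.eventually_ge_atTop 0, eventually_ge_atTop 1] with n h1 h2
  have hl := hlam n h2
  have hlog : 0 ≤ Real.log n := Real.log_natCast_nonneg n
  rw [Real.sqrt_le_left (by positivity)]
  have h3 : Real.log n ≤ n * lam n ^ 2 := by linarith
  have h4 := mul_le_mul_of_nonneg_left h3 (Nat.cast_nonneg (α := ℝ) n)
  linarith

section Probability

variable {Ω S : Type*} [MeasurableSpace Ω] [MeasurableSpace S] {μ : Measure Ω} {P : Measure S}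
  {Z : ℕ → Ω → S}

lemma ae_tendsto_mean (hZ_meas : ∀ i, Measurable (Z i))
    (hZ_law : ∀ i, μ.map (Z i) = P) (hZ_indep : iIndepFun Z μ) {g : S → ℝ} (hg : Measurable g)
    (hgi : Integrable g P) :
    ∀ᵐ ω ∂μ, Tendsto (fun n : ℕ => (1 / (n : ℝ)) * ∑ i : Fin n, g (Z i ω)) atTop
      (𝓝 (∫ z, g z ∂P)) := by
  have hid : ∀ i, IdentDistrib (Z i) (Z 0) μ μ := fun i =>
    ⟨(hZ_meas i).aemeasurable, (hZ_meas 0).aemeasurable, by rw [hZ_law, hZ_law]⟩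
  have h := strong_law_ae_real (μ := μ) (fun i ω => g (Z i ω))
    (by
      rw [← hZ_law 0] at hgi
      exact hgi.comp_measurable (hZ_meas 0))
    (fun i j hij => (hZ_indep.indepFun hij).comp hg hg) (fun i => (hid i).comp hg)
  have hint : ∫ ω, g (Z 0 ω) ∂μ = ∫ z, g z ∂P := by
    rw [← hZ_law 0, integral_map (hZ_meas 0).aemeasurable hg.aestronglyMeasurable]
  filter_upwards [h] with ω hω
  rw [hint] at hω
  refine hω.congr fun n => ?_
  rw [Fin.sum_univ_eq_sum_range (fun i => g (Z i ω)), one_div_mul_eq_div]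

variable [IsProbabilityMeasure μ] [IsProbabilityMeasure P]

lemma exists_ae_eventually_norm_mean_le {E : Type*} [NormedAddCommGroup E]
    [InnerProductSpace ℝ E] [CompleteSpace E] {ξ : S → E} (hZ_meas : ∀ i, Measurable (Z i))
    (hZ_law : ∀ i, μ.map (Z i) = P) (hZ_indep : iIndepFun Z μ)
    (hξ : StronglyMeasurable ξ) (hξ0 : ∫ b, ξ b ∂P = 0) {a : ℝ} (ha : 0 < a)
    (hξi : Integrable (fun b => Real.exp (a * ‖ξ b‖)) P) {lam : ℕ → ℝ}
    (hlam : ∀ n, 1 ≤ n → 0 < lam n)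
    (hrate : Tendsto (fun n : ℕ => (n : ℝ) * lam n ^ 2 - 2 * Real.log n) atTop atTop) :
    ∃ C : ℝ, 0 ≤ C ∧ ∀ᵐ ω ∂μ, ∀ᶠ n : ℕ in atTop,
      ‖(1 / (n : ℝ)) • ∑ i : Fin n, ξ (Z i ω)‖ ≤ C * lam n := by
  obtain ⟨C, hC, h⟩ := exists_ae_eventually_norm_sum_le hZ_meas hZ_law hZ_indep hξ hξ0 ha hξi
  refine ⟨C, hC.le, ?_⟩
  filter_upwards [h] with ω hω
  filter_upwards [hω, eventually_sqrt_mul_log_le hlam hrate, eventually_ge_atTop 1]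
    with n h1 h2 h3
  have hn : (0 : ℝ) < n := by exact_mod_cast h3
  rw [Fin.sum_univ_eq_sum_range (fun i => ξ (Z i ω)), norm_smul,
    Real.norm_of_nonneg (by positivity), one_div_mul_eq_div, div_le_iff₀ hn]
  calc _ ≤ C * √(n * Real.log n) := h1
    _ ≤ C * (n * lam n) := by gcongr
    _ = C * lam n * n := by ring

end Probability

end ElasticNet

/-! ### Universal strong consistency -/

theorem mainTheorem2
    {𝒳 : Type*} [MetricSpace 𝒳] [TopologicalSpace.SeparableSpace 𝒳]
    [MeasurableSpace 𝒳] [BorelSpace 𝒳]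
    {𝒴 : Type*} [NormedAddCommGroup 𝒴] [InnerProductSpace ℝ 𝒴] [CompleteSpace 𝒴]
    [TopologicalSpace.SeparableSpace 𝒴] [MeasurableSpace 𝒴] [BorelSpace 𝒴]
    {Γ : Type*} [Countable Γ]
    (φ : Γ → 𝒳 → 𝒴) (κ : ℝ) (hφ : ElasticNet.IsFeatureFamily φ κ)
    (w : Γ → ℝ) (hw : ∀ γ, 0 ≤ w γ) (ε : ℝ) (hε : 0 < ε)
    (P : Measure (𝒳 × 𝒴)) [IsProbabilityMeasure P]
    (fstar : 𝒳 → 𝒴) (hf_meas : Measurable fstar) (hf_bdd : ∃ C : ℝ, ∀ x, ‖fstar x‖ ≤ C)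
    (σ L : ℝ) (hσ : 0 < σ) (hL : 0 < L) (hnoise : ElasticNet.IsNoise P fstar σ L)
    (hdense : ElasticNet.SpanDense φ P.fst)
    {Ω : Type*} [MeasurableSpace Ω] (μ : Measure Ω) [IsProbabilityMeasure μ]
    (Z : ℕ → Ω → 𝒳 × 𝒴) (hZ_meas : ∀ i, Measurable (Z i))
    (hZ_law : ∀ i, μ.map (Z i) = P) (hZ_indep : iIndepFun Z μ)
    (lam : ℕ → ℝ) (hlam_pos : ∀ n, 1 ≤ n → 0 < lam n)
    (hlam_zero : Tendsto lam atTop (𝓝 0))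
    (hlam_rate : Tendsto (fun n : ℕ => (n : ℝ) * lam n ^ 2 - 2 * Real.log n) atTop atTop) :
    (∀ n, 1 ≤ n → ∀ ω, ∃! β : ElasticNet.EllTwo Γ,
      ElasticNet.IsElasticNetEstimator φ w ε (lam n) (fun i : Fin n => Z i ω) β) ∧
    ∀ βhat : ℕ → Ω → ElasticNet.EllTwo Γ,
      (∀ n, 1 ≤ n → ∀ ω,
        ElasticNet.IsElasticNetEstimator φ w ε (lam n) (fun i : Fin n => Z i ω) (βhat n ω)) →
      ∀ᵐ ω ∂μ, Tendsto (fun n => ElasticNet.predictionError φ P fstar (βhat n ω))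
        atTop (𝓝 0) := by
  open ElasticNet in
  refine ⟨fun n hn ω => hφ.existsUnique_isElasticNetEstimator hw hε (hlam_pos n hn) _,
    fun βhat hβ => ?_⟩
  obtain ⟨B, hB⟩ := hf_bdd
  have : SecondCountableTopology 𝒴 := UniformSpace.secondCountable_of_separable 𝒴
  set M := ∫ z, hφ.gram z.1 ∂P with hM
  obtain ⟨C, -, hG⟩ := exists_ae_eventually_norm_mean_le hZ_meas hZ_law hZ_indep
    (hφ.stronglyMeasurable_adjoint_noise hf_meas)
    (hnoise.integral_adjoint_eq_zero hφ hf_meas)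
    (by positivity) (hnoise.integrable_exp_norm_adjoint hL hφ hf_meas) hlam_pos hlam_rate
  have hKm : StronglyMeasurable fun z : 𝒳 × 𝒴 => hφ.gram z.1 - M :=
    (hφ.stronglyMeasurable_gram.comp_measurable measurable_fst).sub stronglyMeasurable_const
  have hK0 : ∫ z, (hφ.gram z.1 - M) ∂P = 0 := by
    rw [integral_sub hφ.integrable_gram (integrable_const M)]
    simp [hM]
  have hKi : Integrable (fun z : 𝒳 × 𝒴 => Real.exp (1 * ‖hφ.gram z.1 - M‖)) P := by
    refine Integrable.of_bound (Real.measurable_exp.comp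
      (hKm.norm.measurable.const_mul 1)).aestronglyMeasurable (Real.exp (κ + ‖M‖))
      (ae_of_all _ fun z => ?_)
    rw [Real.norm_of_nonneg (Real.exp_pos _).le, one_mul]
    exact Real.exp_le_exp.2 ((norm_sub_le _ _).trans
      (add_le_add (hφ.norm_gram_le z.1) le_rfl))
  obtain ⟨C', hC', hK⟩ := exists_ae_eventually_norm_mean_le hZ_meas hZ_law hZ_indep hKm hK0
    one_pos hKi hlam_pos hlam_rate
  have hcomp : ∀ j : ℕ, ∃ β : EllTwo Γ, penalty w ε β ≠ ∞ ∧
      ∫ x, ‖predictor φ β x - fstar x‖ ^ 2 ∂P.fst ≤ 1 / ((j : ℝ) + 1) := fun j =>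
    hdense.exists_integral_le hφ hw hε.le hf_meas hB (by positivity)
  -- Countably many comparison points suffice, so a single almost sure event carries the strong law
  -- for all of them.
  choose b hb_pen hb using hcomp
  have hmeas : ∀ β : EllTwo Γ, Measurable fun x => ‖predictor φ β x - fstar x‖ ^ 2 := fun β =>
    ((hφ.measurable_predictor β).sub hf_meas).norm.pow_const 2
  have hint : ∀ β : EllTwo Γ, Integrable (fun x => ‖predictor φ β x - fstar x‖ ^ 2) P.fst :=
    hφ.integrable_norm_predictor_sub_sq hf_meas hB P.fst
  have hmean : ∀ᵐ ω ∂μ, ∀ j : ℕ, Tendsto (fun n : ℕ => (1 / (n : ℝ)) *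
      ∑ i : Fin n, ‖predictor φ (b j) (Z i ω).1 - fstar (Z i ω).1‖ ^ 2) atTop
      (𝓝 (∫ x, ‖predictor φ (b j) x - fstar x‖ ^ 2 ∂P.fst)) := by
    refine ae_all_iff.2 fun j => ?_
    rw [← integral_fst_eq _ (hmeas (b j))]
    exact ae_tendsto_mean hZ_meas hZ_law hZ_indep ((hmeas (b j)).comp measurable_fst)
      ((hint (b j)).comp_measurable measurable_fst)
  filter_upwards [hG, hK, hmean] with ω hGω hKω hmω
  simp only [hφ.predictionError_eq hf_meas hB]
  -- The factor `4 + 4 * C' / ε` is that of `inner_tensorSq_le`, doubled by the splitting through `b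
  -- j`; it is independent of `j`. The quantity `D` does depend on `j`, but it is multiplied by `lam
  -- n`, which tends to zero.
  refine tendsto_ofReal_zero_of_eventually_le (A := 2 * (4 + 4 * C' / ε)) (by positivity)
    fun j => ?_
  set D := (penalty w ε (b j)).toReal + ε * ‖b j‖ ^ 2 + 4 * C ^ 2 / ε with hD
  refine ⟨_, fun n => (1 / (n : ℝ)) *
    ∑ i : Fin n, ‖predictor φ (b j) (Z i ω).1 - fstar (Z i ω).1‖ ^ 2 + lam n * D, hb j, ?_, ?_⟩
  · simpa using (hmω j).add (hlam_zero.mul_const D)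
  · filter_upwards [hGω, hKω, eventually_ge_atTop 1] with n h1 h2 hn
    have h3 := (hβ n hn ω).inner_tensorSq_le hφ hw hε (hlam_pos n hn) hn (hb_pen j) fstar hC' h1 h2
    rw [hM, hφ.inner_integral_gram] at h3
    -- This is the integrability of the error for the target `0`.
    have hΔ : Integrable (fun x => ‖predictor φ (βhat n ω - b j) x‖ ^ 2) P.fst := by
      simpa using hφ.integrable_norm_predictor_sub_sq (f := fun _ => (0 : 𝒴)) (C := 0)
        measurable_const (by simp) P.fst (βhat n ω - b j)
    have h4 : ∫ x, ‖predictor φ (βhat n ω) x - fstar x‖ ^ 2 ∂P.fst ≤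
        2 * ∫ x, ‖predictor φ (βhat n ω - b j) x‖ ^ 2 ∂P.fst
          + 2 * ∫ x, ‖predictor φ (b j) x - fstar x‖ ^ 2 ∂P.fst := by
      rw [← integral_const_mul, ← integral_const_mul,
        ← integral_add (hΔ.const_mul 2) ((hint (b j)).const_mul 2)]
      refine integral_mono (hint _) ((hΔ.const_mul 2).add ((hint (b j)).const_mul 2)) fun x => ?_
      have h5 := norm_add_le (predictor φ (βhat n ω - b j) x) (predictor φ (b j) x - fstar x)
      rw [hφ.predictor_sub, sub_add_sub_cancel] at h5
      simp only [hφ.predictor_sub]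
      nlinarith [norm_nonneg (predictor φ (βhat n ω) x - fstar x),
        sq_nonneg (‖predictor φ (βhat n ω) x - predictor φ (b j) x‖
          - ‖predictor φ (b j) x - fstar x‖)]
    rw [mul_assoc 2]
    linarith
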